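/- Let $a,b,c$ be nonzero real numbers and $\epsilon_0,d,m,w$ positive real numbers with $d^2\ne m$. Consider the Benney--Roskes/Zakharov--Rubenchik system for a complex function $\psi$ and a real function $\varphi$ of $(x,y,t)\in\mathbb R^3$, $$i\psi_t+a\psi_{xx}+\epsilon_0\psi_{yy}=(b-wm)|\psi|^2\psi-w\psi\,\{m\partial_t+(mc-d)\partial_y\}\varphi,$$ $$\varphi_{xx}+(1-mc^2)\varphi_{yy}-m\varphi_{tt}-2mc\,\varphi_{yt}=\{m\partial_t+(mc-d)\partial_y\}|\psi|^2 .$$ (1) The linear change of variables $t=m\xi+d\sqrt m\,\eta$, $y=(mc-d)\xi+\sqrt m(cd-1)\eta$ is invertible. If $(\psi,\varphi)$ is a smooth solution on $\mathbb R^3$ of the system above, then, in the variables $(x,\xi,\eta)$, renamed $(x,y,t)$, the pair $(\psi,\phi)$ with $\phi=\varphi_\xi$ is a solution of $$ia_1\psi_t+a\psi_{xx}+a_2\psi_{yy}+a_3\psi_{tt}+a_4\psi_{ty}+ia_5\psi_y=(b-wm)|\psi|^2\psi-w\psi\phi,$$ $$\phi_{xx}+\frac1{d^2-m}(\phi_{yy}-\phi_{tt})=(|\psi|^2)_{yy},\qquad(\ast)$$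 where $$a_1=\frac{d-mc}{(d^2-m)\sqrt m},\quad a_2=\frac{\epsilon_0d^2}{(d^2-m)^2},\quad a_3=\frac{\epsilon_0m}{(d^2-m)^2},\quad a_4=-\frac{2\epsilon_0d\sqrt m}{(d^2-m)^2},\quad a_5=\frac{dc-1}{d^2-m}.$$ (2) Write $\psi=u+iv$. On every nonempty connected open subset of the space $\mathbb R^6$ of the variables $(x,y,t,u,v,\phi)$, the smooth vector fields that are infinitesimal Lie point symmetries of $(\ast)$ (that is, fields $V$ whose second prolongation annihilates the equations of $(\ast)$ at every second-order jet over that subset which satisfies them) form a real Lie algebra of dimension exactly six, with basis (the restrictions of) $$\bar{\mathcal X}_1=\partial_t,\quad \bar{\mathcal X}_2=\partial_x,\quad \bar{\mathcal X}_3=\partial_y,\quad \bar{\mathcal X}_4=-v\partial_u+u\partial_v,$$ $$\bar{\mathcal X}_5=(dt+\sqrt m\,y)(-v\partial_u+u\partial_v)+\frac1{w\sqrt m}\partial_\phi,$$ $$\bar{\mathcal X}_6=(dt+\sqrt m\,y)^2(-v\partial_u+u\partial_v)+\frac{2(dt+\sqrt m\,y)}{w\sqrt m}\partial_\phi .$$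 (3) The commutators are $$[\bar{\mathcal X}_1,\bar{\mathcal X}_5]=d\,\bar{\mathcal X}_4,\quad[\bar{\mathcal X}_1,\bar{\mathcal X}_6]=2d\,\bar{\mathcal X}_5,\quad[\bar{\mathcal X}_3,\bar{\mathcal X}_5]=\sqrt m\,\bar{\mathcal X}_4,\quad[\bar{\mathcal X}_3,\bar{\mathcal X}_6]=2\sqrt m\,\bar{\mathcal X}_5,$$ and $[\bar{\mathcal X}_i,\bar{\mathcal X}_j]=0$ for all other pairs $i<j$. -/

import Mathlib

open scoped ContDiff

noncomputable section

namespace BRZR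

/-- The space of independent variables `(x, y, t)`, numbered `0, 1, 2`. -/
abbrev Base := Fin 3 → ℝ

/-- The space of real dependent variables `(u, v, φ)`, numbered `0, 1, 2`, where `ψ = u + i v`. -/
abbrev Fib := Fin 3 → ℝ

/-- The space of all variables `(x, y, t; u, v, φ)`. A vector field
`ξ^x ∂_x + ξ^y ∂_y + ξ^t ∂_t + η^u ∂_u + η^v ∂_v + η^φ ∂_φ` is a map `Total → Total`,
`z ↦ (ξ z, η z)`. -/
abbrev Total := Base × Fib

/-- Second-order jets: base point, values, first derivatives (`J.2.2.1 i` is the derivative with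
respect to the `i`-th variable) and second derivatives (`J.2.2.2 i j`). -/
abbrev Jet := Base × Fib × (Fin 3 → Fib) × (Fin 3 → Fin 3 → Fib)

/-- Partial derivative with respect to the `i`-th independent variable. -/
def pd {G : Type*} [NormedAddCommGroup G] [NormedSpace ℝ G] (i : Fin 3) (f : Base → G) :
    Base → G :=
  fun p => fderiv ℝ f p (Pi.single i 1)

/-- The second-order jet of `f` at `p`. -/
def jet (f : Base → Fib) (p : Base) : Jet :=
  (p, f p, fun i => pd i f p, fun i j => pd i (pd j f) p)

/-- The characteristic `Q = η - ∑ₖ ξ^k ∂ₖ f` of the vector field `V = (ξ, η)`, along `f`. -/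
def characteristic (V : Total → Total) (f : Base → Fib) : Base → Fib :=
  fun q => (V (q, f q)).2 - ∑ k, (V (q, f q)).1 k • pd k f q

/-- The second prolongation of the vector field `V = (ξ, η)`, a tangent vector of the jet space at
the second-order jet of `f` at `p`: its components are `ξ`, `η` and
`η_J = D_J Q + ∑ₖ ξ^k ∂ₖ ∂_J f` for `|J| = 1, 2`. Total derivatives are computed along `f`; the
derivatives of `f` of order three cancel, so that only the second-order jet of `f` matters. -/
def prolongation (V : Total → Total) (f : Base → Fib) (p : Base) : Jet :=
  ((V (p, f p)).1, (V (p, f p)).2,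
    fun i => pd i (characteristic V f) p + ∑ k, (V (p, f p)).1 k • pd k (pd i f) p,
    fun i j => pd i (pd j (characteristic V f)) p
      + ∑ k, (V (p, f p)).1 k • pd k (pd i (pd j f)) p)

/-- `V` is a (smooth) infinitesimal Lie point symmetry on the open set `Ω` of the second-order
system `Δ = 0`: the derivative of `Δ` along the second prolongation of `V` vanishes at each jet over
`Ω` on which `Δ` vanishes. Each jet is the jet of some smooth `f`. -/
def IsLieSymmetry {G : Type*} [NormedAddCommGroup G] [NormedSpace ℝ G] (Δ : Jet → G)
    (Ω : Set Total) (V : Total → Total) : Prop :=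
  ContDiffOn ℝ ∞ V Ω ∧
    ∀ f : Base → Fib, ContDiff ℝ ∞ f → ∀ p : Base, (p, f p) ∈ Ω →
      Δ (jet f p) = 0 → fderiv ℝ Δ (jet f p) (prolongation V f p) = 0

/-- The complex number `u + i v`. -/
def toC (r : Fib) : ℂ := ⟨r 0, r 1⟩

/-- The original system for `ψ`, `φ` as functions of `(x, y, t)`. -/
def SolvesOriginal (a b c ε₀ d m w : ℝ) (ψ : Base → ℂ) (φ : Base → ℝ) : Prop :=
  ∀ p : Base,
    Complex.I * pd 2 ψ p + a * pd 0 (pd 0 ψ) p + ε₀ * pd 1 (pd 1 ψ) p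
      = (b - w * m) * (‖ψ p‖ ^ 2 : ℝ) * ψ p
        - w * ψ p * ((m * pd 2 φ p + (m * c - d) * pd 1 φ p : ℝ) : ℂ) ∧
    pd 0 (pd 0 φ) p + (1 - m * c ^ 2) * pd 1 (pd 1 φ) p - m * pd 2 (pd 2 φ) p
        - 2 * m * c * pd 2 (pd 1 φ) p
      = m * pd 2 (fun q => ‖ψ q‖ ^ 2) p + (m * c - d) * pd 1 (fun q => ‖ψ q‖ ^ 2) p

/-- The linear change of variables: the old variables `(x, y, t)` as functions of the new ones
`(x, ξ, η)`, `y = (mc - d) ξ + √m (cd - 1) η`, `t = m ξ + d √m η`. -/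
def change (c d m : ℝ) (q : Base) : Base :=
  ![q 0, (m * c - d) * q 1 + √m * (c * d - 1) * q 2, m * q 1 + d * √m * q 2]

/-- The new unknowns `(Re ψ, Im ψ, ∂φ/∂ξ)` as functions of `(x, ξ, η)`. -/
def transform (c d m : ℝ) (ψ : Base → ℂ) (φ : Base → ℝ) : Base → Fib :=
  fun q => ![(ψ (change c d m q)).re, (ψ (change c d m q)).im,
    pd 1 (fun r => φ (change c d m r)) q]

/-- The left-hand side minus the right-hand side of the first equation of the transformed system,
where the new variables `(ξ, η)` are again called `(y, t)`. -/
def eqA (a b c ε₀ d m w : ℝ) (J : Jet) : ℂ :=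
  let a₁ : ℝ := (d - m * c) / ((d ^ 2 - m) * √m)
  let a₂ : ℝ := ε₀ * d ^ 2 / (d ^ 2 - m) ^ 2
  let a₃ : ℝ := ε₀ * m / (d ^ 2 - m) ^ 2
  let a₄ : ℝ := -(2 * ε₀ * d * √m) / (d ^ 2 - m) ^ 2
  let a₅ : ℝ := (d * c - 1) / (d ^ 2 - m)
  let ψ : ℂ := toC J.2.1
  let φ : ℝ := J.2.1 2
  let ψy : ℂ := toC (J.2.2.1 1)
  let ψt : ℂ := toC (J.2.2.1 2)
  let ψxx : ℂ := toC (J.2.2.2 0 0)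
  let ψyy : ℂ := toC (J.2.2.2 1 1)
  let ψtt : ℂ := toC (J.2.2.2 2 2)
  let ψty : ℂ := toC (J.2.2.2 2 1)
  Complex.I * a₁ * ψt + a * ψxx + a₂ * ψyy + a₃ * ψtt + a₄ * ψty + Complex.I * a₅ * ψy
    - ((b - w * m) * (‖ψ‖ ^ 2 : ℝ) * ψ - w * ψ * φ)

/-- The left-hand side minus the right-hand side of the second equation of the transformed system,
`φ_xx + (φ_yy - φ_tt) / (d² - m) = (|ψ|²)_yy`, with
`(|ψ|²)_yy = 2 (u u_yy + v v_yy + u_y² + v_y²)`. -/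
def eqB (d m : ℝ) (J : Jet) : ℝ :=
  let u := J.2.1 0
  let v := J.2.1 1
  let uy := J.2.2.1 1 0
  let vy := J.2.2.1 1 1
  let uyy := J.2.2.2 1 1 0
  let vyy := J.2.2.2 1 1 1
  let φxx := J.2.2.2 0 0 2
  let φyy := J.2.2.2 1 1 2
  let φtt := J.2.2.2 2 2 2
  φxx + 1 / (d ^ 2 - m) * (φyy - φtt) - 2 * (u * uyy + v * vyy + uy ^ 2 + vy ^ 2)

/-- The transformed system, as a function on the second-order jets. -/
def system (a b c ε₀ d m w : ℝ) (J : Jet) : ℂ × ℝ :=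
  (eqA a b c ε₀ d m w J, eqB d m J)

/-- The phase rotation `-v ∂_u + u ∂_v`. -/
def rot (z : Total) : Total := (0, ![-z.2 1, z.2 0, 0])

/-- The coordinate field `∂_φ`. -/
def dφ (_ : Total) : Total := (0, ![0, 0, 1])

/-- The function `d t + √m y`. -/
def phase (d m : ℝ) (z : Total) : ℝ := d * z.1 2 + √m * z.1 1

/-- The six vector fields; `gen d m w i` is the field number `i + 1`. -/
def gen (d m w : ℝ) : Fin 6 → Total → Total :=
  ![fun _ => (Pi.single 2 1, 0),
    fun _ => (Pi.single 0 1, 0),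
    fun _ => (Pi.single 1 1, 0),
    rot,
    fun z => phase d m z • rot z + (1 / (w * √m)) • dφ z,
    fun z => phase d m z ^ 2 • rot z + (2 * phase d m z / (w * √m)) • dφ z]

end BRZR

end

/-!
The linearized equations at a jet are polynomial in the jet variables, and on the system the
second derivatives can be varied almost freely. Their coefficients force the components of a
symmetry along `(x, y, t)` to be constant in the fibres, with a scalar differential `μ`. In the
first-order terms the decisive fact is that the gradient `(0, n, d)` of the phase `s = d t + n y`,
with `n = √m`, lies in the kernel of the second-order part of the first equation but is not
annihilated by its drift `a₁ ∂_t + a₅ ∂_y`. This gives `μ = 0` and makes the action on `ψ`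
multiplication by `α + i β`, where `α` and `β` depend on `s` only. The terms of order zero give
`α = 0` and identify the `φ`-component with `1 / (w √m)` times the derivative of `β`. Since
`d ^ 2 ≠ m`, the gradient of `s` is not null for the wave operator of the second equation, so the
third derivative of `β` vanishes: the three coefficients of `β` and the three translations are the
six parameters of the algebra.
-/

noncomputable section

namespace BRZR

open Filter Topology

section Calculus

variable {E F G : Type*} [NormedAddCommGroup E] [NormedSpace ℝ E] [NormedAddCommGroup F]
  [NormedSpace ℝ F] [NormedAddCommGroup G] [NormedSpace ℝ G]

theorem differentiableAt_fderiv {f : E → G} {z : E} (hf : ContDiffAt ℝ 2 f z) :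
    DifferentiableAt ℝ (fderiv ℝ f) z :=
  (hf.fderiv_right (m := 1) one_add_one_eq_two.le).differentiableAt one_ne_zero

theorem fderiv_fderiv_apply {f : E → G} {z : E} (hf : DifferentiableAt ℝ (fderiv ℝ f) z)
    (a b : E) : fderiv ℝ (fderiv ℝ f) z a b = fderiv ℝ (fun y => fderiv ℝ f y b) z a := by
  simp [fderiv_clm_apply hf (differentiableAt_const b)]

theorem fderiv_fderiv_comm {f : E → G} {z : E} (hf : ContDiffAt ℝ 2 f z) (a b : E) :
    fderiv ℝ (fderiv ℝ f) z a b = fderiv ℝ (fderiv ℝ f) z b a :=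
  hf.isSymmSndFDerivAt (by simp) a b

theorem fderiv_clm_comp_apply (L : F →L[ℝ] G) {f : E → F} {z : E} (hf : DifferentiableAt ℝ f z)
    (b : E) : fderiv ℝ (fun y => L (f y)) z b = L (fderiv ℝ f z b) :=
  DFunLike.congr_fun (L.hasFDerivAt.comp z hf.hasFDerivAt).fderiv b

theorem fderiv_apply_of_cubic_on_line {f : E → G} {x v : E} (hf : DifferentiableAt ℝ f x)
    (c₀ c₁ c₂ c₃ : G) (h : ∀ s : ℝ, f (x + s • v) = c₀ + s • c₁ + s ^ 2 • c₂ + s ^ 3 • c₃) :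
    fderiv ℝ f x v = c₁ := by
  have hcubic := ((((hasDerivAt_id (0 : ℝ)).smul_const c₁).const_add c₀).add
    ((hasDerivAt_pow 2 (0 : ℝ)).smul_const c₂)).add ((hasDerivAt_pow 3 (0 : ℝ)).smul_const c₃)
  rw [← hf.lineDeriv_eq_fderiv, lineDeriv, funext h]
  exact (hcubic.congr_deriv (by simp)).deriv

end Calculus

section PartialDerivatives

variable {G : Type*} [NormedAddCommGroup G] [NormedSpace ℝ G]

theorem contDiffAt_pd {f : Base → G} {p : Base} {k n : WithTop ℕ∞} (hf : ContDiffAt ℝ n f p)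
    (hkn : k + 1 ≤ n) (i : Fin 3) : ContDiffAt ℝ k (pd i f) p :=
  (hf.fderiv_right hkn).clm_apply contDiffAt_const

theorem contDiff_pd {f : Base → G} {k n : WithTop ℕ∞} (hf : ContDiff ℝ n f) (hkn : k + 1 ≤ n)
    (i : Fin 3) : ContDiff ℝ k (pd i f) :=
  contDiff_iff_contDiffAt.2 fun _ => contDiffAt_pd hf.contDiffAt hkn i

theorem pd_congr {f g : Base → G} {p : Base} (h : f =ᶠ[𝓝 p] g) (i : Fin 3) :
    pd i f p = pd i g p := by
  simp only [pd, h.fderiv_eq]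

theorem pd_comm {f : Base → G} {p : Base} (hf : ContDiffAt ℝ 2 f p) (i j : Fin 3) :
    pd i (pd j f) p = pd j (pd i f) p := by
  have h := differentiableAt_fderiv hf
  exact (fderiv_fderiv_apply h _ _).symm.trans
    ((fderiv_fderiv_comm hf _ _).trans (fderiv_fderiv_apply h _ _))

theorem fderiv_eq_sum_pd (f : Base → G) (p v : Base) :
    fderiv ℝ f p v = ∑ k, v k • pd k f p := by
  conv_lhs => rw [pi_eq_sum_univ' v]
  simp only [map_sum, map_smul, pd]

theorem pd_fderiv_apply {f : Base → G} {X : Base → Base} {p : Base} (hf : ContDiffAt ℝ 2 f p)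
    (hX : DifferentiableAt ℝ X p) (i : Fin 3) :
    pd i (fun q => fderiv ℝ f q (X q)) p
      = fderiv ℝ (pd i f) p (X p) + fderiv ℝ f p (pd i X p) := by
  have h := differentiableAt_fderiv hf
  calc pd i (fun q => fderiv ℝ f q (X q)) p
      = fderiv ℝ (fderiv ℝ f) p (Pi.single i 1) (X p) + fderiv ℝ f p (pd i X p) := by
        simp [pd, fderiv_clm_apply h hX, add_comm]
    _ = fderiv ℝ (pd i f) p (X p) + fderiv ℝ f p (pd i X p) := by
        rw [fderiv_fderiv_comm hf, fderiv_fderiv_apply h]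
        rfl

theorem pd_graph {W : Total → G} {f : Base → Fib} {p : Base}
    (hW : DifferentiableAt ℝ W (p, f p)) (hf : DifferentiableAt ℝ f p) (i : Fin 3) :
    pd i (fun q => W (q, f q)) p = fderiv ℝ W (p, f p) (Pi.single i 1, pd i f p) := by
  have hgraph : HasFDerivAt (fun q => (q, f q)) _ p := (hasFDerivAt_id p).prodMk hf.hasFDerivAt
  exact DFunLike.congr_fun
    (HasFDerivAt.comp p (g := W) (f := fun q => (q, f q)) hW.hasFDerivAt hgraph).fderiv _

theorem pd_pd_graph {W : Total → G} {f : Base → Fib} {p : Base}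
    (hW : ContDiffAt ℝ 2 W (p, f p)) (hf : ContDiff ℝ 2 f) (i j : Fin 3) :
    pd i (pd j (fun q => W (q, f q))) p
      = fderiv ℝ (fderiv ℝ W) (p, f p) (Pi.single i 1, pd i f p) (Pi.single j 1, pd j f p)
        + fderiv ℝ W (p, f p) (0, pd i (pd j f) p) := by
  have hf_diff : Differentiable ℝ f := hf.differentiable two_ne_zero
  have hfirst : pd j (fun q => W (q, f q))
      =ᶠ[𝓝 p] fun q => fderiv ℝ W (q, f q) (Pi.single j 1, pd j f q) := by
    have hcont : ContinuousAt (fun q => (q, f q)) p :=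
      (continuous_id.prodMk hf.continuous).continuousAt
    filter_upwards [hcont.eventually (hW.eventually (by simp))] with q hq
    exact pd_graph (hq.differentiableAt two_ne_zero) (hf_diff q) j
  have hfib : DifferentiableAt ℝ (pd j f) p :=
    (contDiff_pd hf one_add_one_eq_two.le j).differentiable one_ne_zero p
  have hgraph : DifferentiableAt ℝ (fun q => (q, f q)) p := differentiableAt_id.prodMk (hf_diff p)
  have hpair : HasFDerivAt (fun q => ((Pi.single j 1 : Base), pd j f q)) _ p :=
    (hasFDerivAt_const _ p).prodMk hfib.hasFDerivAt
  have hdW := differentiableAt_fderiv hW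
  have hcomp : DifferentiableAt ℝ (fun q => fderiv ℝ W (q, f q)) p := hdW.comp p hgraph
  calc pd i (pd j (fun q => W (q, f q))) p
      = fderiv ℝ (fun q => fderiv ℝ W (q, f q) (Pi.single j 1, pd j f q)) p (Pi.single i 1) :=
        pd_congr hfirst i
    _ = pd i (fun q => fderiv ℝ W (q, f q)) p (Pi.single j 1, pd j f p)
          + fderiv ℝ W (p, f p) (0, pd i (pd j f) p) := by
        rw [fderiv_clm_apply hcomp hpair.differentiableAt, hpair.fderiv, add_comm]
        rfl
    _ = _ := by rw [pd_graph hdW (hf_diff p)]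

end PartialDerivatives

open Polynomial in
theorem exists_derivative_eq {F : Type*} [Field F] [CharZero F] {N : ℕ} {p : F[X]}
    (hp : p ∈ degreeLT F N) : ∃ q ∈ degreeLT F (N + 1), derivative q = p := by
  classical
  suffices h : degreeLT F N ≤ (degreeLT F (N + 1)).map derivative from h hp
  rw [degreeLT_eq_span_X_pow, Submodule.span_le]
  intro _ hX
  obtain ⟨i, hi, rfl⟩ := by simpa using hX
  have hne : (i : F) + 1 ≠ 0 := by exact_mod_cast i.succ_ne_zero
  exact ⟨monomial (i + 1) ((i : F) + 1)⁻¹,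
    monomial_coe_mem_degreeLT (⟨i + 1, by lia⟩ : Fin (N + 1)) _,
    by simp [hne, X_pow_eq_monomial]⟩

section Prolongation

variable {G : Type*} [NormedAddCommGroup G] [NormedSpace ℝ G]

theorem pd_sub {f g : Base → G} {p : Base} (hf : DifferentiableAt ℝ f p)
    (hg : DifferentiableAt ℝ g p) (i : Fin 3) :
    pd i (fun q => f q - g q) p = pd i f p - pd i g p :=
  DFunLike.congr_fun (fderiv_fun_sub hf hg) _

theorem pd_characteristic_of {F : Base → Base × G} {f : Base → G} {p : Base}
    (hF : DifferentiableAt ℝ F p) (hf : ContDiffAt ℝ 2 f p) (i : Fin 3) :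
    pd i (fun q => (F q).2 - fderiv ℝ f q (F q).1) p
      = (pd i F p).2 - fderiv ℝ f p (pd i F p).1 - fderiv ℝ (pd i f) p (F p).1 := by
  have hfirst : DifferentiableAt ℝ (fun q => fderiv ℝ f q (F q).1) p :=
    (differentiableAt_fderiv hf).clm_apply hF.fst
  have hfst : pd i (fun q => (F q).1) p = (pd i F p).1 := by simp [pd, fderiv.fst hF]
  have hsnd : pd i (fun q => (F q).2) p = (pd i F p).2 := by simp [pd, fderiv.snd hF]
  rw [pd_sub hF.snd hfirst, pd_fderiv_apply hf hF.fst, hfst, hsnd]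
  abel

theorem pd_pd_characteristic_of {F : Base → Base × G} {f : Base → G} {p : Base}
    (hF : ContDiffAt ℝ 2 F p) (hf : ContDiffAt ℝ 3 f p) (i j : Fin 3) :
    pd i (pd j fun q => (F q).2 - fderiv ℝ f q (F q).1) p
      = (pd i (pd j F) p).2 - fderiv ℝ f p (pd i (pd j F) p).1
        - fderiv ℝ (pd i f) p (pd j F p).1 - fderiv ℝ (pd j f) p (pd i F p).1
        - fderiv ℝ (pd i (pd j f)) p (F p).1 := by
  have hf₂ : ContDiffAt ℝ 2 f p := hf.of_le (by norm_num)
  have hdf : ContDiffAt ℝ 2 (pd j f) p := contDiffAt_pd hf (by norm_num) j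
  have hF₁ : DifferentiableAt ℝ F p := hF.differentiableAt two_ne_zero
  have hdF : DifferentiableAt ℝ (pd j F) p :=
    (contDiffAt_pd hF one_add_one_eq_two.le j).differentiableAt one_ne_zero
  have hfirst : pd j (fun q => (F q).2 - fderiv ℝ f q (F q).1) =ᶠ[𝓝 p] fun q =>
      ((pd j F q).2 - fderiv ℝ f q (pd j F q).1) - fderiv ℝ (pd j f) q (F q).1 := by
    filter_upwards [hF.eventually (by simp), hf₂.eventually (by simp)] with q hFq hfq
    exact pd_characteristic_of (hFq.differentiableAt two_ne_zero) hfq j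
  have hleft : DifferentiableAt ℝ (fun q => (pd j F q).2 - fderiv ℝ f q (pd j F q).1) p :=
    hdF.snd.sub ((differentiableAt_fderiv hf₂).clm_apply hdF.fst)
  have hright : DifferentiableAt ℝ (fun q => fderiv ℝ (pd j f) q (F q).1) p :=
    (differentiableAt_fderiv hdf).clm_apply hF₁.fst
  have hfst : pd i (fun q => (F q).1) p = (pd i F p).1 := by simp [pd, fderiv.fst hF₁]
  rw [pd_congr hfirst, pd_sub hleft hright, pd_characteristic_of hdF hf₂,
    pd_fderiv_apply hdf hF₁.fst, hfst]
  abel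

/-- The total derivative in the `i`-th direction, as a tangent vector of `Total`, of a map with
first derivatives `f₁`. -/
def tangentVec (f₁ : Fin 3 → Fib) (i : Fin 3) : Total := (Pi.single i 1, f₁ i)

/-- The part of the second-order prolongation coefficients of a vector field with second derivative
`H` that does not involve the second derivatives of the dependent variables. -/
def lowPart (H : Total →L[ℝ] Total →L[ℝ] Total) (f₁ : Fin 3 → Fib) (i j : Fin 3) : Fib :=
  (H (tangentVec f₁ i) (tangentVec f₁ j)).2
    - ∑ k, (H (tangentVec f₁ i) (tangentVec f₁ j)).1 k • f₁ k

/-- The part of the second-order prolongation coefficients of a vector field with derivative `L`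
that is linear in the second derivatives `f₂` of the dependent variables. -/
def topPart (L : Total →L[ℝ] Total) (f₁ : Fin 3 → Fib) (f₂ : Fin 3 → Fin 3 → Fib)
    (i j : Fin 3) : Fib :=
  (L (0, f₂ i j)).2 - ∑ k, (L (0, f₂ i j)).1 k • f₁ k
    - ∑ k, (L (tangentVec f₁ j)).1 k • f₂ k i - ∑ k, (L (tangentVec f₁ i)).1 k • f₂ k j

/-- The second prolongation at a jet with derivatives `f₁`, `f₂` of a vector field with value `v`,
derivative `L` and second derivative `H` at the point under the jet. -/
def prolongAt (v : Total) (L : Total →L[ℝ] Total) (H : Total →L[ℝ] Total →L[ℝ] Total)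
    (f₁ : Fin 3 → Fib) (f₂ : Fin 3 → Fin 3 → Fib) : Jet :=
  (v.1, v.2, fun i => (L (tangentVec f₁ i)).2 - ∑ k, (L (tangentVec f₁ i)).1 k • f₁ k,
    fun i j => lowPart H f₁ i j + topPart L f₁ f₂ i j)

theorem prolongation_eq {V : Total → Total} {f : Base → Fib} {p : Base}
    (hV : ContDiffAt ℝ 2 V (p, f p)) (hf : ContDiff ℝ 3 f) :
    prolongation V f p
      = prolongAt (V (p, f p)) (fderiv ℝ V (p, f p)) (fderiv ℝ (fderiv ℝ V) (p, f p))
          (fun i => pd i f p) (fun i j => pd i (pd j f) p) := by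
  have hf₂ : ContDiff ℝ 2 f := hf.of_le (by norm_num)
  have hfp : DifferentiableAt ℝ f p := hf.differentiable (by norm_num) p
  have hV₁ : DifferentiableAt ℝ V (p, f p) := hV.differentiableAt two_ne_zero
  have hF : ContDiffAt ℝ 2 (fun q => V (q, f q)) p :=
    hV.comp p (contDiffAt_id.prodMk hf₂.contDiffAt)
  have hchar : characteristic V f = fun q => (V (q, f q)).2 - fderiv ℝ f q (V (q, f q)).1 :=
    funext fun q => by rw [fderiv_eq_sum_pd]; rfl
  simp only [prolongation, prolongAt, lowPart, topPart, tangentVec, ← fderiv_eq_sum_pd, hchar,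
    pd_characteristic_of (hF.differentiableAt two_ne_zero) hf₂.contDiffAt,
    pd_pd_characteristic_of hF hf.contDiffAt, pd_graph hV₁ hfp, pd_pd_graph hV hf₂]
  refine Prod.ext rfl (Prod.ext rfl (Prod.ext (funext fun i => ?_) (funext₂ fun i j => ?_)))
  · simp
  · simp only [Prod.fst_add, Prod.snd_add, map_add]
    abel

end Prolongation

section Taylor

/-- The quadratic polynomial with value `r`, first derivatives `f₁` and second derivatives `f₂`
at `p`. -/
def taylor (p : Base) (r : Fib) (f₁ : Fin 3 → Fib) (f₂ : Fin 3 → Fin 3 → Fib) (q : Base) : Fib :=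
  r + ∑ i, (q i - p i) • f₁ i + (1 / 2 : ℝ) • ∑ i, ∑ j, ((q i - p i) * (q j - p j)) • f₂ i j

theorem contDiff_taylor (p : Base) (r : Fib) (f₁ : Fin 3 → Fib) (f₂ : Fin 3 → Fin 3 → Fib) :
    ContDiff ℝ ∞ (taylor p r f₁ f₂) := by
  unfold taylor
  fun_prop

theorem pd_taylor (p : Base) (r : Fib) (f₁ : Fin 3 → Fib) {f₂ : Fin 3 → Fin 3 → Fib}
    (hsymm : ∀ i j, f₂ i j = f₂ j i) (i : Fin 3) :
    pd i (taylor p r f₁ f₂) = fun q => f₁ i + ∑ j, (q j - p j) • f₂ i j := by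
  funext q
  refine fderiv_apply_of_cubic_on_line ((contDiff_taylor p r f₁ f₂).differentiable (by simp) q)
    (taylor p r f₁ f₂ q) _ ((1 / 2 : ℝ) • f₂ i i) 0 fun s => ?_
  ext α
  fin_cases i <;>
    simp [taylor, Fin.sum_univ_three, hsymm 1 0, hsymm 2 0, hsymm 2 1] <;> ring

theorem jet_taylor (p : Base) (r : Fib) (f₁ : Fin 3 → Fib) {f₂ : Fin 3 → Fin 3 → Fib}
    (hsymm : ∀ i j, f₂ i j = f₂ j i) : jet (taylor p r f₁ f₂) p = (p, r, f₁, f₂) := by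
  have hpd : ∀ i j, pd i (pd j (taylor p r f₁ f₂)) p = f₂ i j := fun i j => by
    rw [pd_taylor p r f₁ hsymm, hsymm i j]
    exact fderiv_apply_of_cubic_on_line (by fun_prop) (f₁ j) (f₂ j i) 0 0 fun s => by
      simp [Pi.single_apply]
  simp only [jet, hpd]
  simp [pd_taylor p r f₁ hsymm, taylor]

end Taylor

/-- The coefficients of a system of the same shape as the transformed system, where `κ` is the
coefficient of `|ψ|²ψ` and `σ` is the coefficient of `φ_yy - φ_tt`. -/
structure Coeffs where
  (a a₁ a₂ a₃ a₄ a₅ κ σ w : ℝ)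

/-- The coefficients of the transformed system. -/
def coeffs (a b c ε₀ d m w : ℝ) : Coeffs where
  a := a
  a₁ := (d - m * c) / ((d ^ 2 - m) * √m)
  a₂ := ε₀ * d ^ 2 / (d ^ 2 - m) ^ 2
  a₃ := ε₀ * m / (d ^ 2 - m) ^ 2
  a₄ := -(2 * ε₀ * d * √m) / (d ^ 2 - m) ^ 2
  a₅ := (d * c - 1) / (d ^ 2 - m)
  κ := b - w * m
  σ := 1 / (d ^ 2 - m)
  w := w

namespace Coeffs

variable (K : Coeffs)

/-- The part of the system that is linear in the second derivatives `f₂`, at the value `r`. -/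
def principal (r : Fib) (f₂ : Fin 3 → Fin 3 → Fib) : Fib :=
  ![K.a * f₂ 0 0 0 + K.a₂ * f₂ 1 1 0 + K.a₃ * f₂ 2 2 0 + K.a₄ * f₂ 2 1 0,
    K.a * f₂ 0 0 1 + K.a₂ * f₂ 1 1 1 + K.a₃ * f₂ 2 2 1 + K.a₄ * f₂ 2 1 1,
    f₂ 0 0 2 + K.σ * (f₂ 1 1 2 - f₂ 2 2 2) - 2 * (r 0 * f₂ 1 1 0 + r 1 * f₂ 1 1 1)]

/-- The real first-order operator `a₁ ∂_t + a₅ ∂_y`. -/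
def drift (f₁ : Fin 3 → Fib) (α : Fin 3) : ℝ :=
  K.a₁ * f₁ 2 α + K.a₅ * f₁ 1 α

/-- The part of the system that does not involve second derivatives. -/
def lowerOrder (r : Fib) (f₁ : Fin 3 → Fib) : Fib :=
  ![-K.drift f₁ 1 - K.κ * (r 0 ^ 2 + r 1 ^ 2) * r 0 + K.w * r 0 * r 2,
    K.drift f₁ 0 - K.κ * (r 0 ^ 2 + r 1 ^ 2) * r 1 + K.w * r 1 * r 2,
    -2 * (f₁ 1 0 ^ 2 + f₁ 1 1 ^ 2)]

/-- The system in real form: the real and imaginary parts of its first equation, and its second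
equation. -/
def equations (J : Jet) : Fib :=
  K.principal J.2.1 J.2.2.2 + K.lowerOrder J.2.1 J.2.2.1

/-- The derivative of the lower-order part in the direction `(p, p₁)`, together with the derivative
of `principal` with respect to its first argument. -/
def lowerLinearization (r : Fib) (f₁ : Fin 3 → Fib) (f₂ : Fin 3 → Fin 3 → Fib) (p : Fib)
    (p₁ : Fin 3 → Fib) : Fib :=
  ![-K.drift p₁ 1 - K.κ * (2 * (r 0 * p 0 + r 1 * p 1) * r 0 + (r 0 ^ 2 + r 1 ^ 2) * p 0)
      + K.w * (p 0 * r 2 + r 0 * p 2),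
    K.drift p₁ 0 - K.κ * (2 * (r 0 * p 0 + r 1 * p 1) * r 1 + (r 0 ^ 2 + r 1 ^ 2) * p 1)
      + K.w * (p 1 * r 2 + r 1 * p 2),
    -4 * (f₁ 1 0 * p₁ 1 0 + f₁ 1 1 * p₁ 1 1) - 2 * (p 0 * f₂ 1 1 0 + p 1 * f₂ 1 1 1)]

/-- The derivative of the system at the jet `J` in the direction `P`. -/
def linearization (J P : Jet) : Fib :=
  K.principal J.2.1 P.2.2.2 + K.lowerLinearization J.2.1 J.2.2.1 J.2.2.2 P.2.1 P.2.2.1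

theorem differentiable_equations : Differentiable ℝ K.equations := by
  refine differentiable_pi.2 fun α => ?_
  fin_cases α <;>
    simp only [equations, principal, lowerOrder, drift, Pi.add_apply, Fin.zero_eta, Fin.mk_one,
      Fin.reduceFinMk, Matrix.cons_val] <;>
    fun_prop

theorem fderiv_equations (J P : Jet) : fderiv ℝ K.equations J P = K.linearization J P := by
  refine fderiv_apply_of_cubic_on_line (K.differentiable_equations J) (K.equations J) _
    ![-K.κ * ((P.2.1 0 ^ 2 + P.2.1 1 ^ 2) * J.2.1 0
        + 2 * (J.2.1 0 * P.2.1 0 + J.2.1 1 * P.2.1 1) * P.2.1 0) + K.w * P.2.1 0 * P.2.1 2,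
      -K.κ * ((P.2.1 0 ^ 2 + P.2.1 1 ^ 2) * J.2.1 1
        + 2 * (J.2.1 0 * P.2.1 0 + J.2.1 1 * P.2.1 1) * P.2.1 1) + K.w * P.2.1 1 * P.2.1 2,
      -2 * (P.2.1 0 * P.2.2.2 1 1 0 + P.2.1 1 * P.2.2.2 1 1 1
        + P.2.2.1 1 0 ^ 2 + P.2.2.1 1 1 ^ 2)]
    ![-K.κ * (P.2.1 0 ^ 2 + P.2.1 1 ^ 2) * P.2.1 0,
      -K.κ * (P.2.1 0 ^ 2 + P.2.1 1 ^ 2) * P.2.1 1, 0] fun s => ?_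
  ext α
  fin_cases α <;>
    simp [equations, linearization, principal, lowerOrder, lowerLinearization, drift] <;> ring

/-- The condition for an infinitesimal symmetry at a point with fibre coordinates `r`, for a vector
field with value `v`, derivative `L` and second derivative `H` at this point. -/
def IsSymmetryAt (r : Fib) (v : Total) (L : Total →L[ℝ] Total)
    (H : Total →L[ℝ] Total →L[ℝ] Total) : Prop :=
  ∀ (f₁ : Fin 3 → Fib) (f₂ : Fin 3 → Fin 3 → Fib), (∀ i j, f₂ i j = f₂ j i) →
    K.principal r f₂ + K.lowerOrder r f₁ = 0 →
      K.principal r (prolongAt v L H f₁ f₂).2.2.2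
        + K.lowerLinearization r f₁ f₂ v.2 (prolongAt v L H f₁ f₂).2.2.1 = 0

/-- The infinitesimal symmetries of the real form of the system on `Ω`. -/
def IsSymmetryOn (Ω : Set Total) (V : Total → Total) : Prop :=
  ContDiffOn ℝ ∞ V Ω ∧
    ∀ z ∈ Ω, K.IsSymmetryAt z.2 (V z) (fderiv ℝ V z) (fderiv ℝ (fderiv ℝ V) z)

end Coeffs

section System

variable (a b c ε₀ d m w : ℝ)

/-- The real-linear map `(u, v, s) ↦ (u + i v, s)`, which recovers the system from its real form. -/
def complexify : Fib →L[ℝ] ℂ × ℝ :=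
  ((Complex.equivRealProdCLM.symm : ℝ × ℝ →L[ℝ] ℂ).comp
    ((ContinuousLinearMap.proj 0).prod (ContinuousLinearMap.proj 1))).prod
      (ContinuousLinearMap.proj 2)

theorem complexify_apply (r : Fib) : complexify r = (toC r, r 2) := by
  refine Prod.ext (Complex.ext ?_ ?_) rfl <;> simp [complexify, toC]

theorem complexify_eq_zero {r : Fib} : complexify r = 0 ↔ r = 0 := by
  simp [complexify_apply, toC, Complex.ext_iff, funext_iff, Fin.forall_fin_succ, and_assoc]

theorem norm_toC_sq (r : Fib) : ‖toC r‖ ^ 2 = r 0 ^ 2 + r 1 ^ 2 := by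
  rw [← Complex.normSq_eq_norm_sq, Complex.normSq_apply, toC, sq, sq]

theorem system_eq_complexify :
    system a b c ε₀ d m w = fun J => complexify ((coeffs a b c ε₀ d m w).equations J) := by
  funext J
  simp only [complexify_apply, system, eqA, eqB, norm_toC_sq]
  refine Prod.ext (Complex.ext ?_ ?_) ?_ <;>
    simp [toC, Coeffs.equations, Coeffs.principal, Coeffs.lowerOrder, Coeffs.drift, coeffs,
      -Complex.ofReal_div, -Complex.ofReal_mul, -Complex.ofReal_neg, -Complex.ofReal_pow,
      -Complex.ofReal_add, -Complex.ofReal_sub] <;>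
    ring

theorem system_eq_zero_iff (J : Jet) :
    system a b c ε₀ d m w J = 0 ↔ (coeffs a b c ε₀ d m w).equations J = 0 := by
  rw [system_eq_complexify, complexify_eq_zero]

theorem fderiv_system_eq_zero_iff (J P : Jet) : fderiv ℝ (system a b c ε₀ d m w) J P = 0
    ↔ (coeffs a b c ε₀ d m w).linearization J P = 0 := by
  rw [system_eq_complexify, fderiv_clm_comp_apply _ (Coeffs.differentiable_equations _ J),
    complexify_eq_zero, Coeffs.fderiv_equations]

theorem isLieSymmetry_system_iff {Ω : Set Total} (hΩ : IsOpen Ω) (V : Total → Total) :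
    IsLieSymmetry (system a b c ε₀ d m w) Ω V ↔ (coeffs a b c ε₀ d m w).IsSymmetryOn Ω V := by
  refine and_congr_right fun hV => ?_
  have hVz : ∀ z ∈ Ω, ContDiffAt ℝ 2 V z := fun z hz =>
    (hV.contDiffAt (hΩ.mem_nhds hz)).of_le (by norm_cast)
  simp only [system_eq_zero_iff, fderiv_system_eq_zero_iff]
  refine ⟨?_, fun h f hf p hp hJ => ?_⟩
  · rintro h ⟨p, r⟩ hz f₁ f₂ hsymm hJ
    have hjet := jet_taylor p r f₁ hsymm
    have hvalue : taylor p r f₁ f₂ p = r := congrArg (fun J : Jet => J.2.1) hjet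
    have hf₁ : (fun i => pd i (taylor p r f₁ f₂) p) = f₁ := congrArg (fun J : Jet => J.2.2.1) hjet
    have hf₂ : (fun i j => pd i (pd j (taylor p r f₁ f₂)) p) = f₂ :=
      congrArg (fun J : Jet => J.2.2.2) hjet
    have hsymm_at := h _ (contDiff_taylor p r f₁ f₂) p (by rwa [hvalue]) (by rwa [hjet])
    rwa [prolongation_eq (by rw [hvalue]; exact hVz _ hz)
      ((contDiff_taylor p r f₁ f₂).of_le (by norm_cast)), hf₁, hf₂, hvalue, hjet]
      at hsymm_at
  · rw [prolongation_eq (hVz _ hp) (hf.of_le (by norm_cast))]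
    exact h (p, f p) hp (fun i => pd i f p) (fun i j => pd i (pd j f) p)
      (fun i j => pd_comm (hf.contDiffAt.of_le (by norm_cast)) i j) hJ

end System

/-- The symmetric array with the given entries. -/
def symmArray (xx yy tt xy xt yt : Fib) : Fin 3 → Fin 3 → Fib :=
  ![![xx, xy, xt], ![xy, yy, yt], ![xt, yt, tt]]

theorem symmArray_comm (xx yy tt xy xt yt : Fib) (i j : Fin 3) :
    symmArray xx yy tt xy xt yt i j = symmArray xx yy tt xy xt yt j i := by
  fin_cases i <;> fin_cases j <;> rfl

/-- The coordinate vector of the `i`-th independent variable. -/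
def baseVec (i : Fin 3) : Total := (Pi.single i 1, 0)

/-- The coordinate vector of the `α`-th dependent variable. -/
def fibVec (α : Fin 3) : Total := (0, Pi.single α 1)

theorem eq_sum_baseVec_add (b : Total) : b = ∑ i, b.1 i • baseVec i + (0, b.2) := by
  ext α <;> simp [baseVec, Prod.fst_sum, Prod.snd_sum, Finset.sum_apply, Pi.single_apply]

theorem snd_apply_fib (L : Total →L[ℝ] Total) (r : Fib) (α : Fin 3) : (L (0, r)).2 α
    = r 0 * (L (fibVec 0)).2 α + r 1 * (L (fibVec 1)).2 α + r 2 * (L (fibVec 2)).2 α := by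
  have hr : ((0, r) : Total) = r 0 • fibVec 0 + r 1 • fibVec 1 + r 2 • fibVec 2 := by
    ext β <;> [skip; fin_cases β] <;> simp [fibVec]
  simp [hr]

theorem tangentVec_zero (i : Fin 3) : tangentVec 0 i = baseVec i := rfl

theorem tangentVec_eq (f₁ : Fin 3 → Fib) (i : Fin 3) :
    tangentVec f₁ i = baseVec i + (0, f₁ i) := by
  simp [tangentVec, baseVec]

theorem topPart_add (L : Total →L[ℝ] Total) (f₁ : Fin 3 → Fib) (g h : Fin 3 → Fin 3 → Fib) :
    topPart L f₁ (g + h) = topPart L f₁ g + topPart L f₁ h := by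
  funext i j
  have hL : L (0, g i j + h i j) = L (0, g i j) + L (0, h i j) := by simp [← map_add]
  simp only [topPart, Pi.add_apply, hL, Prod.fst_add, Prod.snd_add, add_smul, smul_add,
    Finset.sum_add_distrib]
  abel

theorem topPart_zero_apply (L : Total →L[ℝ] Total) (g : Fin 3 → Fin 3 → Fib) (i j α : Fin 3) :
    topPart L 0 g i j α = (L (0, g i j)).2 α - ∑ k, (L (baseVec j)).1 k * g k i α
      - ∑ k, (L (baseVec i)).1 k * g k j α := by
  simp [topPart, tangentVec_zero]

theorem topPart_zero_sub_topPart (L : Total →L[ℝ] Total) (f₁ : Fin 3 → Fib)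
    (g : Fin 3 → Fin 3 → Fib) :
    topPart L 0 g - topPart L f₁ g = fun i j => ∑ k, ((L (0, g i j)).1 k • f₁ k
      + (L (0, f₁ j)).1 k • g k i + (L (0, f₁ i)).1 k • g k j) := by
  funext i j
  simp only [topPart, tangentVec_eq, map_add, Prod.fst_add, Pi.add_apply, Pi.sub_apply, add_smul,
    Finset.sum_add_distrib, Pi.zero_apply, ← Prod.zero_eq_mk, map_zero, Prod.fst_zero, smul_zero,
    Finset.sum_const_zero, zero_smul]
  abel

namespace Coeffs

variable {K : Coeffs} {r : Fib} {v : Total} {L : Total →L[ℝ] Total}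
  {H : Total →L[ℝ] Total →L[ℝ] Total}

theorem principal_symmArray (K : Coeffs) (r xx yy tt xy xt yt : Fib) :
    K.principal r (symmArray xx yy tt xy xt yt)
      = ![K.a * xx 0 + K.a₂ * yy 0 + K.a₃ * tt 0 + K.a₄ * yt 0,
        K.a * xx 1 + K.a₂ * yy 1 + K.a₃ * tt 1 + K.a₄ * yt 1,
        xx 2 + K.σ * (yy 2 - tt 2) - 2 * (r 0 * yy 0 + r 1 * yy 1)] := rfl

theorem principal_add (K : Coeffs) (r : Fib) (g h : Fin 3 → Fin 3 → Fib) :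
    K.principal r (g + h) = K.principal r g + K.principal r h := by
  ext α
  fin_cases α <;> simp [principal] <;> ring

theorem principal_sub (K : Coeffs) (r : Fib) (g h : Fin 3 → Fin 3 → Fib) :
    K.principal r (g - h) = K.principal r g - K.principal r h := by
  ext α
  fin_cases α <;> simp [principal] <;> ring

/-- The second derivatives completing the value `r` and the first derivatives `f₁` to a jet that
satisfies the system and has no second derivatives besides `∂_x²`. -/
def particular (K : Coeffs) (r : Fib) (f₁ : Fin 3 → Fib) : Fin 3 → Fin 3 → Fib :=
  symmArray ![-K.lowerOrder r f₁ 0 / K.a, -K.lowerOrder r f₁ 1 / K.a, -K.lowerOrder r f₁ 2]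
    0 0 0 0 0

theorem particular_comm (K : Coeffs) (r : Fib) (f₁ : Fin 3 → Fib) (i j : Fin 3) :
    K.particular r f₁ i j = K.particular r f₁ j i :=
  symmArray_comm _ _ _ _ _ _ i j

theorem principal_particular (ha : K.a ≠ 0) (r : Fib) (f₁ : Fin 3 → Fib) :
    K.principal r (K.particular r f₁) + K.lowerOrder r f₁ = 0 := by
  ext α
  fin_cases α <;> simp [principal, particular, symmArray, mul_div_cancel₀ _ ha]

theorem lowerLinearization_add (K : Coeffs) (r : Fib) (f₁ : Fin 3 → Fib)
    (g h : Fin 3 → Fin 3 → Fib) (p : Fib) (p₁ : Fin 3 → Fib) :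
    K.lowerLinearization r f₁ (g + h) p p₁ = K.lowerLinearization r f₁ g p p₁
      - ![0, 0, 2 * (p 0 * h 1 1 0 + p 1 * h 1 1 1)] := by
  ext α
  fin_cases α <;> simp [lowerLinearization]
  ring

theorem IsSymmetryAt.principal_topPart (h : K.IsSymmetryAt r v L H) (ha : K.a ≠ 0)
    (f₁ : Fin 3 → Fib) {g : Fin 3 → Fin 3 → Fib} (hsymm : ∀ i j, g i j = g j i)
    (hg : K.principal r g = 0) :
    K.principal r (topPart L f₁ g) = ![0, 0, 2 * (v.2 0 * g 1 1 0 + v.2 1 * g 1 1 1)] := by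
  have h₀ := h f₁ (K.particular r f₁) (K.particular_comm r f₁) (principal_particular ha r f₁)
  have h₁ := h f₁ (K.particular r f₁ + g)
    (fun i j => congrArg₂ (· + ·) (K.particular_comm r f₁ i j) (hsymm i j))
    (by rw [principal_add, hg, add_zero, principal_particular ha])
  have hsplit : (prolongAt v L H f₁ (K.particular r f₁ + g)).2.2.2
      = (prolongAt v L H f₁ (K.particular r f₁)).2.2.2 + topPart L f₁ g := by
    funext i j
    simp only [prolongAt, topPart_add, Pi.add_apply, add_assoc]
  rw [hsplit, principal_add, lowerLinearization_add] at h₁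
  change _ + (K.lowerLinearization _ _ _ _ (prolongAt v L H f₁ (K.particular r f₁)).2.2.1 - _) = 0
    at h₁
  linear_combination h₁ - h₀

end Coeffs

namespace Coeffs

/-- The conditions on the coefficients, with respect to the phase `d t + n y`, that determine the
symmetry algebra. The conditions `null_n` and `null_d` say that the gradient of the phase is
isotropic for the quadratic form `a₂ η² + a₃ τ² + a₄ τ η` in the covector `η dy + τ dt`. -/
structure Nondegenerate (K : Coeffs) (n d : ℝ) : Prop where
  a_ne : K.a ≠ 0
  a₄_ne : K.a₄ ≠ 0
  σ_ne : K.σ ≠ 0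
  w_ne : K.w ≠ 0
  a₂_sub_a₃_ne : K.a₂ - K.a₃ ≠ 0
  d_ne : d ≠ 0
  sq_sub_sq_ne : n ^ 2 - d ^ 2 ≠ 0
  null_n : 2 * K.a₂ * n + K.a₄ * d = 0
  null_d : 2 * K.a₃ * d + K.a₄ * n = 0
  drift_ne : K.a₁ * d + K.a₅ * n ≠ 0

theorem Nondegenerate.null_form {K : Coeffs} {n d : ℝ} (hK : K.Nondegenerate n d) :
    K.a₂ * n ^ 2 + K.a₃ * d ^ 2 + K.a₄ * d * n = 0 := by
  linear_combination n / 2 * hK.null_n + d / 2 * hK.null_d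

namespace IsSymmetryAt

variable {K : Coeffs} {n d : ℝ} {r : Fib} {v : Total} {L : Total →L[ℝ] Total}
  {H : Total →L[ℝ] Total →L[ℝ] Total}

theorem principal_bilinear (h : K.IsSymmetryAt r v L H) (ha : K.a ≠ 0) (f₁ : Fin 3 → Fib)
    {g : Fin 3 → Fin 3 → Fib} (hsymm : ∀ i j, g i j = g j i) (hg : K.principal r g = 0) :
    K.principal r (fun i j => ∑ k, ((L (0, g i j)).1 k • f₁ k + (L (0, f₁ j)).1 k • g k i
      + (L (0, f₁ i)).1 k • g k j)) = 0 := by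
  rw [← topPart_zero_sub_topPart, principal_sub, h.principal_topPart ha f₁ hsymm hg,
    h.principal_topPart ha 0 hsymm hg, sub_self]

theorem fst_apply_fib (h : K.IsSymmetryAt r v L H) (hK : K.Nondegenerate n d) (s : Fib) :
    (L (0, s)).1 = 0 := by
  have hL₀ : L (0, 0) = 0 := map_zero L
  have hφ_xy := fun f₁ => congrFun (h.principal_bilinear hK.a_ne f₁
    (symmArray_comm 0 0 0 ![0, 0, 1] 0 0) (by simp [principal_symmArray])) 2
  have hφ_xt := fun f₁ => congrFun (h.principal_bilinear hK.a_ne f₁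
    (symmArray_comm 0 0 0 0 ![0, 0, 1] 0) (by simp [principal_symmArray])) 2
  ext k
  fin_cases k
  · simpa [principal, symmArray, Fin.sum_univ_three, hL₀, hK.σ_ne] using hφ_xy ![0, s, 0]
  · simpa [principal, symmArray, Fin.sum_univ_three, hL₀] using hφ_xy ![s, 0, 0]
  · simpa [principal, symmArray, Fin.sum_univ_three, hL₀] using hφ_xt ![s, 0, 0]

theorem snd_apply_fibVec_two (h : K.IsSymmetryAt r v L H) (hK : K.Nondegenerate n d) :
    (L (fibVec 2)).2 0 = 0 ∧ (L (fibVec 2)).2 1 = 0 := by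
  have hφ_yt := h.principal_topPart hK.a_ne 0 (symmArray_comm 0 0 0 0 0 ![0, 0, 1])
    (by simp [principal_symmArray])
  constructor
  · simpa [principal, topPart_zero_apply, snd_apply_fib, symmArray, Fin.sum_univ_three, hK.a₄_ne]
      using congrFun hφ_yt 0
  · simpa [principal, topPart_zero_apply, snd_apply_fib, symmArray, Fin.sum_univ_three, hK.a₄_ne]
      using congrFun hφ_yt 1

theorem conformal (h : K.IsSymmetryAt r v L H) (hK : K.Nondegenerate n d)
    {xx yy tt : ℝ} (xy xt yt : ℝ) (hs : xx + K.σ * (yy - tt) = 0) :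
    (L (baseVec 0)).1 0 * xx + (L (baseVec 0)).1 1 * xy + (L (baseVec 0)).1 2 * xt
      + K.σ * ((L (baseVec 1)).1 0 * xy + (L (baseVec 1)).1 1 * yy + (L (baseVec 1)).1 2 * yt)
      - K.σ * ((L (baseVec 2)).1 0 * xt + (L (baseVec 2)).1 1 * yt + (L (baseVec 2)).1 2 * tt)
      = 0 := by
  have hwave := congrFun (h.principal_topPart hK.a_ne 0 (symmArray_comm ![0, 0, xx] ![0, 0, yy]
    ![0, 0, tt] ![0, 0, xy] ![0, 0, xt] ![0, 0, yt]) (by simp [principal_symmArray, hs])) 2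
  simp only [principal, topPart_zero_apply, snd_apply_fib, symmArray, Fin.sum_univ_three,
    Matrix.cons_val, Matrix.cons_val', (h.snd_apply_fibVec_two hK).1,
    (h.snd_apply_fibVec_two hK).2] at hwave
  linear_combination (L (fibVec 2)).2 2 / 2 * hs - hwave / 2

theorem fst_apply_base (h : K.IsSymmetryAt r v L H) (hK : K.Nondegenerate n d) (hr : r 0 ≠ 0)
    (i k : Fin 3) : (L (baseVec i)).1 k = (L (baseVec 0)).1 0 * (Pi.single i 1 : Base) k := by
  have hxy := h.conformal hK (xx := 0) (yy := 0) (tt := 0) 1 0 0 (by ring)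
  have hxt := h.conformal hK (xx := 0) (yy := 0) (tt := 0) 0 1 0 (by ring)
  have hyt := h.conformal hK (xx := 0) (yy := 0) (tt := 0) 0 0 1 (by ring)
  have hyy := h.conformal hK (xx := -K.σ) (yy := 1) (tt := 0) 0 0 0 (by ring)
  have htt := h.conformal hK (xx := K.σ) (yy := 0) (tt := 1) 0 0 0 (by ring)
  have hu_xy := h.principal_topPart hK.a_ne 0 (symmArray_comm 0 0 0 ![1, 0, 0] 0 0)
    (by simp [principal_symmArray])
  have hu_diag := h.principal_topPart hK.a_ne 0 (symmArray_comm ![0, 0, 2 * K.a₃ * r 0]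
    ![K.a₃, 0, 0] ![-K.a₂, 0, 0] 0 0 0)
    (by ext α; fin_cases α <;> simp [principal_symmArray] <;> ring)
  have h10 : (L (baseVec 1)).1 0 = 0 := by
    have h10_double : -(L (baseVec 1)).1 0 - (L (baseVec 1)).1 0 = 0 := by
      simpa [principal, topPart_zero_apply, snd_apply_fib, symmArray, Fin.sum_univ_three, hr] using
        congrFun hu_xy 2
    linear_combination -h10_double / 2
  have h01 : (L (baseVec 0)).1 1 = 0 := by linear_combination hxy - K.σ * h10
  have h20 : (L (baseVec 2)).1 0 = 0 := by
    simpa [principal, topPart_zero_apply, snd_apply_fib, symmArray, Fin.sum_univ_three, h10, h01,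
      hK.a₄_ne]
      using congrFun hu_xy 0
  have h02 : (L (baseVec 0)).1 2 = 0 := by linear_combination hxt + K.σ * h20
  have h11 : (L (baseVec 1)).1 1 = (L (baseVec 0)).1 0 :=
    mul_left_cancel₀ hK.σ_ne (by linear_combination hyy)
  have h22 : (L (baseVec 2)).1 2 = (L (baseVec 0)).1 0 :=
    mul_left_cancel₀ hK.σ_ne (by linear_combination -htt)
  have h12 : (L (baseVec 1)).1 2 = (L (baseVec 2)).1 1 :=
    mul_left_cancel₀ hK.σ_ne (by linear_combination hyt)
  have h21 : (L (baseVec 2)).1 1 = 0 := by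
    refine (mul_eq_zero.1 ?_).resolve_left (mul_ne_zero hK.a₄_ne hK.a₂_sub_a₃_ne)
    have hu := congrFun hu_diag 0
    simp only [principal, topPart_zero_apply, snd_apply_fib, symmArray, Fin.sum_univ_three,
      Matrix.cons_val, Matrix.cons_val', Pi.zero_apply, (h.snd_apply_fibVec_two hK).1, h10, h20,
      h11, h22, h12] at hu
    linear_combination hu
  fin_cases i <;> fin_cases k <;> simp [h01, h02, h10, h11, h12, h20, h21, h22]

theorem fst_apply (h : K.IsSymmetryAt r v L H) (hK : K.Nondegenerate n d) (hr : r 0 ≠ 0)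
    (b : Total) : (L b).1 = (L (baseVec 0)).1 0 • b.1 := by
  have hL : (L b).1 = ∑ i, b.1 i • (L (baseVec i)).1 := by
    conv_lhs => rw [eq_sum_baseVec_add b]
    simp [h.fst_apply_fib hK, Prod.fst_sum]
  have hbase := h.fst_apply_base hK hr
  generalize (L (baseVec 0)).1 0 = μ at hbase ⊢
  ext k
  simp [hL, hbase, Finset.sum_apply, Pi.single_apply, mul_comm]

end IsSymmetryAt
end Coeffs

/-- At some point, the base components of a vector field with derivative `L` and second derivative
`H` agree, up to an additive constant and to second order, with the homothety with factor `μ`. -/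
structure IsHomotheticAt (L : Total →L[ℝ] Total) (H : Total →L[ℝ] Total →L[ℝ] Total)
    (μ : ℝ) : Prop where
  fst_apply : ∀ b, (L b).1 = μ • b.1
  fst_apply_apply : ∀ a b, (H a b).1 = 0
  symm : ∀ a b, H a b = H b a

namespace IsHomotheticAt

variable {v : Total} {L : Total →L[ℝ] Total} {H : Total →L[ℝ] Total →L[ℝ] Total} {μ : ℝ}

theorem prolongAt_eq (hμ : IsHomotheticAt L H μ) (f₁ : Fin 3 → Fib) {f₂ : Fin 3 → Fin 3 → Fib}
    (hsymm : ∀ i j, f₂ i j = f₂ j i) : prolongAt v L H f₁ f₂ = (v.1, v.2,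
      fun i => (L (tangentVec f₁ i)).2 - μ • f₁ i,
      fun i j => (H (tangentVec f₁ i) (tangentVec f₁ j)).2 + (L (0, f₂ i j)).2
        - (2 * μ) • f₂ i j) := by
  have hsum (i : Fin 3) (g : Fin 3 → Fib) : ∑ k, (L (tangentVec f₁ i)).1 k • g k = μ • g i := by
    simp [hμ.fst_apply, tangentVec, Pi.single_apply]
  have hfib (s : Fib) : (L (0, s)).1 = 0 := by simp [hμ.fst_apply]
  refine Prod.ext rfl (Prod.ext rfl (Prod.ext ?_ ?_))
  · simp only [prolongAt, hsum]
  · funext i j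
    simp only [prolongAt, lowPart, topPart, hsum, hfib, hμ.fst_apply_apply, hsymm j i,
      Pi.zero_apply, zero_smul, Finset.sum_const_zero, two_mul, add_smul]
    abel

end IsHomotheticAt

namespace Coeffs.IsSymmetryAt

variable {K : Coeffs} {n d : ℝ} {r : Fib} {v : Total} {L : Total →L[ℝ] Total}
  {H : Total →L[ℝ] Total →L[ℝ] Total} {μ : ℝ}

theorem snd_two_apply_fibVec (h : K.IsSymmetryAt r v L H) (hK : K.Nondegenerate n d)
    (hμ : IsHomotheticAt L H μ) : (L (fibVec 0)).2 2 = 0 ∧ (L (fibVec 1)).2 2 = 0 := by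
  have hlin (x y : ℝ) : K.a₄ * (x * (L (fibVec 0)).2 2 + y * (L (fibVec 1)).2 2) = 0 := by
    have hxx_yt := congrFun (h.principal_topPart hK.a_ne 0
      (symmArray_comm ![-K.a₄ * x, -K.a₄ * y, 0] 0 0 0 0 ![K.a * x, K.a * y, 0])
      (by ext α; fin_cases α <;> simp [principal_symmArray] <;> ring)) 2
    simp only [principal, topPart_zero_apply, snd_apply_fib, hμ.fst_apply, symmArray, baseVec,
      Fin.sum_univ_three, Matrix.cons_val, Matrix.cons_val', Pi.smul_apply, Pi.zero_apply,
      smul_eq_mul, Pi.single_eq_same, ne_eq, Fin.reduceEq, one_ne_zero, zero_ne_one,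
      not_false_eq_true, Pi.single_eq_of_ne] at hxx_yt
    linear_combination -hxx_yt
  exact ⟨by simpa [hK.a₄_ne] using hlin 1 0, by simpa [hK.a₄_ne] using hlin 0 1⟩

theorem euler (h : K.IsSymmetryAt r v L H) (hK : K.Nondegenerate n d)
    (hμ : IsHomotheticAt L H μ) :
    v.2 0 = r 0 * (L (fibVec 2)).2 2 - (r 0 * (L (fibVec 0)).2 0 + r 1 * (L (fibVec 0)).2 1) ∧
      v.2 1
        = r 1 * (L (fibVec 2)).2 2 - (r 0 * (L (fibVec 1)).2 0 + r 1 * (L (fibVec 1)).2 1) := by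
  obtain ⟨hu, hv⟩ := h.snd_two_apply_fibVec hK hμ
  have hlin (x y : ℝ) : K.a * (v.2 0 * x + v.2 1 * y)
      = K.a * ((r 0 * x + r 1 * y) * (L (fibVec 2)).2 2
        - (r 0 * (x * (L (fibVec 0)).2 0 + y * (L (fibVec 1)).2 0)
          + r 1 * (x * (L (fibVec 0)).2 1 + y * (L (fibVec 1)).2 1))) := by
    have hxx_yy := congrFun (h.principal_topPart hK.a_ne 0
      (symmArray_comm ![-K.a₂ * x, -K.a₂ * y, 2 * K.a * (r 0 * x + r 1 * y)]
        ![K.a * x, K.a * y, 0] 0 0 0 0)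
      (by ext α; fin_cases α <;> simp [principal_symmArray] <;> ring)) 2
    simp only [principal, topPart_zero_apply, snd_apply_fib, hμ.fst_apply, symmArray, baseVec,
      hu, hv, Fin.sum_univ_three, Matrix.cons_val, Matrix.cons_val', Pi.smul_apply, Pi.zero_apply,
      smul_eq_mul, Pi.single_eq_same, ne_eq, Fin.reduceEq, one_ne_zero, zero_ne_one,
      not_false_eq_true, Pi.single_eq_of_ne] at hxx_yy
    linear_combination -hxx_yy / 2
  exact ⟨by simpa [hK.a_ne] using hlin 1 0, by simpa [hK.a_ne] using hlin 0 1⟩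

end Coeffs.IsSymmetryAt

namespace Coeffs.IsSymmetryAt

variable {K : Coeffs} {n d : ℝ} {r : Fib} {v : Total} {L : Total →L[ℝ] Total}
  {H : Total →L[ℝ] Total →L[ℝ] Total} {μ : ℝ}

theorem lowerOrder_eq (h : K.IsSymmetryAt r v L H) (ha : K.a ≠ 0) (hμ : IsHomotheticAt L H μ)
    (f₁ : Fin 3 → Fib) :
    K.principal r (fun i j => (H (tangentVec f₁ i) (tangentVec f₁ j)).2
        + (L (0, K.particular r f₁ i j)).2 - (2 * μ) • K.particular r f₁ i j)
      + K.lowerLinearization r f₁ (K.particular r f₁) v.2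
        (fun i => (L (tangentVec f₁ i)).2 - μ • f₁ i) = 0 := by
  simpa only [hμ.prolongAt_eq f₁ (K.particular_comm r f₁)] using
    h f₁ _ (K.particular_comm r f₁) (principal_particular ha r f₁)

theorem snd_apply_apply_add_fib (h : K.IsSymmetryAt r v L H) (ha : K.a ≠ 0)
    (hμ : IsHomotheticAt L H μ) (s : Fib) :
    (H (baseVec 0 + (0, s)) (baseVec 0 + (0, s))).2 = (H (baseVec 0) (baseVec 0)).2 := by
  have h₀ := h.lowerOrder_eq ha hμ 0
  have h₁ := h.lowerOrder_eq ha hμ ![s, 0, 0]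
  have hpart : K.particular r ![s, 0, 0] = K.particular r 0 := rfl
  have hu := congrArg₂ (· - ·) (congrFun h₁ 0) (congrFun h₀ 0)
  have hv := congrArg₂ (· - ·) (congrFun h₁ 1) (congrFun h₀ 1)
  have hφ := congrArg₂ (· - ·) (congrFun h₁ 2) (congrFun h₀ 2)
  simp only [hpart, principal, lowerLinearization, drift, tangentVec_eq, Matrix.cons_val,
    Prod.mk_zero_zero, add_zero, Pi.zero_apply, Pi.add_apply, Pi.sub_apply] at hu hv hφ
  ext α
  fin_cases α
  · exact mul_left_cancel₀ ha (by linear_combination hu : _ * (H _ _).2 0 = _ * (H _ _).2 0)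
  · exact mul_left_cancel₀ ha (by linear_combination hv : _ * (H _ _).2 1 = _ * (H _ _).2 1)
  · change (H _ _).2 2 = (H _ _).2 2
    linear_combination hφ

theorem snd_apply_baseVec_zero_fib (h : K.IsSymmetryAt r v L H) (ha : K.a ≠ 0)
    (hμ : IsHomotheticAt L H μ) (s : Fib) : (H (baseVec 0) (0, s)).2 = 0 := by
  have hpos := h.snd_apply_apply_add_fib ha hμ s
  have hneg := h.snd_apply_apply_add_fib ha hμ (-s)
  have hs : ((0, -s) : Total) = -(0, s) := by simp
  simp only [hs, map_add, map_neg, add_apply, neg_apply,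
    Prod.snd_add, Prod.snd_neg, hμ.symm (0, s) (baseVec 0)] at hpos hneg
  linear_combination (norm := module) (1 / 4 : ℝ) • hpos - (1 / 4 : ℝ) • hneg

theorem snd_apply_fib_fib (h : K.IsSymmetryAt r v L H) (ha : K.a ≠ 0)
    (hμ : IsHomotheticAt L H μ) (s s' : Fib) : (H (0, s) (0, s')).2 = 0 := by
  have hquad (t : Fib) : (H (0, t) (0, t)).2 = 0 := by
    have ht := h.snd_apply_apply_add_fib ha hμ t
    simpa [hμ.symm (0, t) (baseVec 0), h.snd_apply_baseVec_zero_fib ha hμ] using ht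
  have hadd : ((0, s + s') : Total) = (0, s) + (0, s') := by simp
  have hsum := hquad (s + s')
  simp only [hadd, map_add, add_apply, Prod.snd_add, hquad,
    hμ.symm (0, s') (0, s)] at hsum
  linear_combination (norm := module) (1 / 2 : ℝ) • hsum

theorem mixed_derivatives (h : K.IsSymmetryAt r v L H) (hK : K.Nondegenerate n d)
    (hμ : IsHomotheticAt L H μ) (s₁ s₂ : ℝ) {r' : Fib} (hr' : r' 2 = 0) :
    (2 * K.a₂ * s₁ + K.a₄ * s₂) * (H (baseVec 1) (0, r')).2 0
        + (2 * K.a₃ * s₂ + K.a₄ * s₁) * (H (baseVec 2) (0, r')).2 0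
      = (K.a₁ * s₂ + K.a₅ * s₁) * (r' 0 * (L (fibVec 1)).2 0 - r' 1 * (L (fibVec 0)).2 0
        + (r' 0 * (L (fibVec 0)).2 1 + r' 1 * (L (fibVec 1)).2 1) + μ * r' 1) ∧
    (2 * K.a₂ * s₁ + K.a₄ * s₂) * (H (baseVec 1) (0, r')).2 1
        + (2 * K.a₃ * s₂ + K.a₄ * s₁) * (H (baseVec 2) (0, r')).2 1
      = (K.a₁ * s₂ + K.a₅ * s₁) * (r' 0 * (L (fibVec 1)).2 1 - r' 1 * (L (fibVec 0)).2 1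
        - (r' 0 * (L (fibVec 0)).2 0 + r' 1 * (L (fibVec 1)).2 0) - μ * r' 0) := by
  have hsmul (s : ℝ) : ((0, s • r') : Total) = s • (0, r') := by simp
  have hsymm (i : Fin 3) : H (0, r') (baseVec i) = H (baseVec i) (0, r') := hμ.symm _ _
  obtain ⟨hφu, hφv⟩ := h.snd_apply_fibVec_two hK
  have ha := hK.a_ne
  have h₀ := h.lowerOrder_eq ha hμ 0
  have h₁ := h.lowerOrder_eq ha hμ ![0, s₁ • r', s₂ • r']
  have hu := congrArg₂ (· - ·) (congrFun h₁ 0) (congrFun h₀ 0)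
  have hv := congrArg₂ (· - ·) (congrFun h₁ 1) (congrFun h₀ 1)
  simp only [principal, particular, symmArray, lowerLinearization, lowerOrder, drift, tangentVec_eq,
    Matrix.cons_val, Matrix.cons_val', Pi.add_apply, Pi.sub_apply, Pi.smul_apply, Pi.zero_apply,
    smul_eq_mul, hsmul, map_add, map_smul, add_apply, smul_apply, Prod.snd_add, Prod.smul_snd,
    Prod.mk_zero_zero, map_zero, zero_apply, Prod.snd_zero, h.snd_apply_fib_fib ha hμ, hsymm]
    at hu hv
  simp only [snd_apply_fib L, hr', hφu, hφv, Matrix.cons_val] at hu hv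
  constructor
  · field_simp at hu
    linear_combination hu
  · field_simp at hv
    linear_combination hv

theorem complex_linear (h : K.IsSymmetryAt r v L H) (hK : K.Nondegenerate n d)
    (hμ : IsHomotheticAt L H μ) :
    μ = 0 ∧ (L (fibVec 1)).2 0 = -(L (fibVec 0)).2 1 ∧ (L (fibVec 1)).2 1 = (L (fibVec 0)).2 0 := by
  obtain ⟨huu, huv⟩ := h.mixed_derivatives hK hμ n d (r' := Pi.single 0 1) (by simp)
  obtain ⟨hvu, -⟩ := h.mixed_derivatives hK hμ n d (r' := Pi.single 1 1) (by simp)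
  simp only [hK.null_n, hK.null_d, hK.drift_ne, Pi.single_eq_same, ne_eq, one_ne_zero, zero_ne_one,
    not_false_eq_true, Pi.single_eq_of_ne, zero_mul, mul_zero, one_mul, mul_one, add_zero, zero_add,
    sub_zero, zero_sub, zero_eq_mul, false_or] at huu huv hvu
  exact ⟨by linarith, by linarith, by linarith⟩

theorem snd_apply_null_fibVec_zero (h : K.IsSymmetryAt r v L H) (hK : K.Nondegenerate n d)
    (hμ : IsHomotheticAt L H μ) :
    (H (d • baseVec 1 - n • baseVec 2) (fibVec 0)).2 0 = 0 ∧
      (H (d • baseVec 1 - n • baseVec 2) (fibVec 0)).2 1 = 0 := by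
  obtain ⟨rfl, hvu, hvv⟩ := h.complex_linear hK hμ
  obtain ⟨hu, hv⟩ := h.mixed_derivatives hK hμ 0 1 (r' := Pi.single 0 1) (by simp)
  simp only [hvu, hvv, ← show fibVec 0 = (0, Pi.single 0 1) from rfl, Pi.single_eq_same, ne_eq,
    one_ne_zero, not_false_eq_true, Pi.single_eq_of_ne, zero_mul, mul_zero, one_mul, mul_one,
    mul_neg, add_zero, zero_add, sub_zero, neg_add_cancel, neg_zero, sub_self] at hu hv
  simp only [map_sub, map_smul, sub_apply, smul_apply, Prod.snd_sub, Prod.smul_snd, Pi.sub_apply,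
    Pi.smul_apply, smul_eq_mul]
  constructor <;> refine mul_left_cancel₀ hK.a₄_ne ?_
  · linear_combination d * hu - (H (baseVec 2) (fibVec 0)).2 0 * hK.null_d
  · linear_combination d * hv - (H (baseVec 2) (fibVec 0)).2 1 * hK.null_d

theorem zero_gradient_equation (h : K.IsSymmetryAt r v L H) (hK : K.Nondegenerate n d)
    (hμ : IsHomotheticAt L H μ) :
    K.principal r (fun i j => (H (baseVec i) (baseVec j)).2)
      + K.lowerLinearization r 0 0 v.2 (fun i => (L (baseVec i)).2)
      + (K.κ * (r 0 ^ 2 + r 1 ^ 2) - K.w * r 2)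
        • ![r 0 * (L (fibVec 0)).2 0 - r 1 * (L (fibVec 0)).2 1,
          r 1 * (L (fibVec 0)).2 0 + r 0 * (L (fibVec 0)).2 1, 0] = 0 := by
  obtain ⟨hφu, hφv⟩ := h.snd_apply_fibVec_two hK
  obtain ⟨huφ, hvφ⟩ := h.snd_two_apply_fibVec hK hμ
  obtain ⟨rfl, hvu, hvv⟩ := h.complex_linear hK hμ
  have ha := hK.a_ne
  have hlin := h.lowerOrder_eq ha hμ 0
  have hu := congrFun hlin 0
  have hv := congrFun hlin 1
  have hφ := congrFun hlin 2
  simp only [principal, particular, symmArray, lowerLinearization, lowerOrder, drift,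
    tangentVec_zero, snd_apply_fib L, Matrix.cons_val, Matrix.cons_val', Pi.add_apply, Pi.sub_apply,
    Pi.smul_apply, Pi.zero_apply, smul_eq_mul, hφu, hφv, huφ, hvφ, hvu, hvv] at hu hv hφ
  ext α
  fin_cases α <;>
    simp only [principal, lowerLinearization, drift, Matrix.cons_val, Pi.add_apply, Pi.smul_apply,
      Pi.zero_apply, smul_eq_mul, Fin.zero_eta, Fin.mk_one, Fin.reduceFinMk]
  · field_simp at hu
    linear_combination hu
  · field_simp at hv
    linear_combination hv
  · linear_combination hφ

end Coeffs.IsSymmetryAt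

section OpenSets

variable {E G : Type*} [NormedAddCommGroup E] [NormedSpace ℝ E] [NormedAddCommGroup G]
  [NormedSpace ℝ G] {Ω : Set E} {f g : E → G} {z : E}

theorem fderiv_eq_of_eqOn (hΩ : IsOpen Ω) (h : Ω.EqOn f g) (hz : z ∈ Ω) :
    fderiv ℝ f z = fderiv ℝ g z :=
  (h.eventuallyEq_of_mem (hΩ.mem_nhds hz)).fderiv_eq

theorem contDiffOn_fderiv_apply (hΩ : IsOpen Ω) (hf : ContDiffOn ℝ ∞ f Ω) (b : E) :
    ContDiffOn ℝ ∞ (fun z => fderiv ℝ f z b) Ω :=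
  (hf.fderiv_of_isOpen hΩ (m := ∞) (by simp)).clm_apply contDiffOn_const

theorem differentiableAt_of_contDiffOn (hΩ : IsOpen Ω) (hf : ContDiffOn ℝ ∞ f Ω) (hz : z ∈ Ω) :
    DifferentiableAt ℝ f z :=
  (hf.contDiffAt (hΩ.mem_nhds hz)).differentiableAt (by simp)

theorem contDiffAt_two_of_contDiffOn (hΩ : IsOpen Ω) (hf : ContDiffOn ℝ ∞ f Ω) (hz : z ∈ Ω) :
    ContDiffAt ℝ 2 f z :=
  (hf.contDiffAt (hΩ.mem_nhds hz)).of_le (WithTop.coe_le_coe.2 le_top)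

theorem fderiv_fderiv_eq_of_eqOn (hΩ : IsOpen Ω) (hf : ContDiffOn ℝ ∞ f Ω) {b : E}
    (h : Ω.EqOn (fun y => fderiv ℝ f y b) g) (hz : z ∈ Ω) (a : E) :
    fderiv ℝ (fderiv ℝ f) z a b = fderiv ℝ g z a := by
  rw [fderiv_fderiv_apply (differentiableAt_fderiv (contDiffAt_two_of_contDiffOn hΩ hf hz)),
    fderiv_eq_of_eqOn hΩ h hz]

end OpenSets

theorem fderiv_fst_apply {E : Type*} [NormedAddCommGroup E] [NormedSpace ℝ E] {f : E → Total}
    {z : E} (hf : DifferentiableAt ℝ f z) (b : E) :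
    fderiv ℝ (fun y => (f y).1) z b = (fderiv ℝ f z b).1 :=
  fderiv_clm_comp_apply (.fst ℝ Base Fib) hf b

theorem fderiv_snd_apply_apply {E : Type*} [NormedAddCommGroup E] [NormedSpace ℝ E] {f : E → Total}
    {z : E} (hf : DifferentiableAt ℝ f z) (b : E) (α : Fin 3) :
    fderiv ℝ (fun y => (f y).2 α) z b = (fderiv ℝ f z b).2 α :=
  fderiv_clm_comp_apply ((ContinuousLinearMap.proj α).comp (.snd ℝ Base Fib)) hf b

theorem eqOn_of_fib_ne_zero {G : Type*} [TopologicalSpace G] [T2Space G] {Ω : Set Total}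
    (hΩ : IsOpen Ω) (α : Fin 3) {f g : Total → G} (hf : ContinuousOn f Ω) (hg : ContinuousOn g Ω)
    (h : ∀ z ∈ Ω, z.2 α ≠ 0 → f z = g z) : Ω.EqOn f g := by
  have hdense : Dense {z : Total | z.2 α ≠ 0} :=
    (dense_compl_singleton (0 : ℝ)).preimage ((isOpenMap_eval α).comp isOpenMap_snd)
  exact Set.EqOn.of_subset_closure (s := Ω ∩ {z | z.2 α ≠ 0}) (fun z hz => h z hz.1 hz.2) hf hg
    Set.inter_subset_left (hdense.open_subset_closure_inter hΩ)

namespace Coeffs.IsSymmetryOn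

variable {K : Coeffs} {n d : ℝ} {Ω : Set Total} {V : Total → Total} {z : Total}

theorem fst_fderiv_eq_smul (hV : K.IsSymmetryOn Ω V) (hK : K.Nondegenerate n d) (hΩ : IsOpen Ω)
    (b : Total) (hz : z ∈ Ω) :
    (fderiv ℝ V z b).1 = (fderiv ℝ V z (baseVec 0)).1 0 • b.1 := by
  have hcont (b : Total) : ContinuousOn (fun z => fderiv ℝ V z b) Ω :=
    (contDiffOn_fderiv_apply hΩ hV.1 b).continuousOn
  have hcont₀ := (continuous_apply (0 : Fin 3)).comp_continuousOn (hcont (baseVec 0)).fst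
  exact eqOn_of_fib_ne_zero hΩ 0 (hcont b).fst (hcont₀.smul continuousOn_const)
    (fun y hy hr => (hV.2 y hy).fst_apply hK hr b) hz

theorem fderiv_fderiv_comm (hV : K.IsSymmetryOn Ω V) (hΩ : IsOpen Ω) (hz : z ∈ Ω) (a b : Total) :
    fderiv ℝ (fderiv ℝ V) z a b = fderiv ℝ (fderiv ℝ V) z b a :=
  BRZR.fderiv_fderiv_comm (contDiffAt_two_of_contDiffOn hΩ hV.1 hz) a b

theorem fst_fderiv_fderiv (hV : K.IsSymmetryOn Ω V) (hK : K.Nondegenerate n d) (hΩ : IsOpen Ω)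
    (hz : z ∈ Ω) (a b : Total) : (fderiv ℝ (fderiv ℝ V) z a b).1 = 0 := by
  set m : Total → ℝ := fun y => (fderiv ℝ V y (baseVec 0)).1 0
  have hm : DifferentiableAt ℝ m z := by
    have := differentiableAt_of_contDiffOn hΩ (contDiffOn_fderiv_apply hΩ hV.1 (baseVec 0)) hz
    fun_prop
  have hsecond (a b : Total) : (fderiv ℝ (fderiv ℝ V) z a b).1 = fderiv ℝ m z a • b.1 := by
    have hb := differentiableAt_of_contDiffOn hΩ (contDiffOn_fderiv_apply hΩ hV.1 b) hz
    rw [fderiv_fderiv_apply (differentiableAt_fderiv (contDiffAt_two_of_contDiffOn hΩ hV.1 hz)),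
      ← fderiv_fst_apply hb,
      fderiv_eq_of_eqOn hΩ (fun y hy => hV.fst_fderiv_eq_smul hK hΩ b hy) hz,
      fderiv_smul_const hm]
    rfl
  have hcross (a b : Total) : fderiv ℝ m z a • b.1 = fderiv ℝ m z b • a.1 := by
    rw [← hsecond, ← hsecond, hV.fderiv_fderiv_comm hΩ hz]
  have hy : fderiv ℝ m z (baseVec 1) = 0 := by
    simpa [baseVec] using congrFun (hcross (baseVec 1) (baseVec 0)) 0
  have hzero : fderiv ℝ m z a = 0 := by
    simpa [hy, show (baseVec 1).1 1 = 1 from rfl] using congrFun (hcross a (baseVec 1)) 1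
  rw [hsecond, hzero, zero_smul]

theorem isHomotheticAt (hV : K.IsSymmetryOn Ω V) (hK : K.Nondegenerate n d) (hΩ : IsOpen Ω)
    (hz : z ∈ Ω) : IsHomotheticAt (fderiv ℝ V z) (fderiv ℝ (fderiv ℝ V) z) 0 := by
  have hμ : IsHomotheticAt (fderiv ℝ V z) (fderiv ℝ (fderiv ℝ V) z)
      ((fderiv ℝ V z (baseVec 0)).1 0) :=
    ⟨fun b => hV.fst_fderiv_eq_smul hK hΩ b hz, hV.fst_fderiv_fderiv hK hΩ hz,
      hV.fderiv_fderiv_comm hΩ hz⟩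
  rwa [((hV.2 z hz).complex_linear hK hμ).1] at hμ

theorem exists_fst_eq (hV : K.IsSymmetryOn Ω V) (hK : K.Nondegenerate n d) (hΩ : IsOpen Ω)
    (hconn : IsPreconnected Ω) : ∃ x, ∀ z ∈ Ω, (V z).1 = x :=
  hΩ.exists_is_const_of_fderiv_eq_zero hconn (hV.1.fst.differentiableOn (by simp)) fun z hz => by
    refine ContinuousLinearMap.ext fun b => ?_
    rw [fderiv_fst_apply (differentiableAt_of_contDiffOn hΩ hV.1 hz),
      (hV.isHomotheticAt hK hΩ hz).fst_apply, zero_smul]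
    rfl

end Coeffs.IsSymmetryOn

section PhaseFunctions

/-- The linear form `d dt + n dy`, the gradient of the phase `d t + n y`. -/
def phaseForm (n d : ℝ) : Total →L[ℝ] ℝ :=
  d • (ContinuousLinearMap.proj 2).comp (.fst ℝ Base Fib)
    + n • (ContinuousLinearMap.proj 1).comp (.fst ℝ Base Fib)

/-- The derivative with respect to the phase `d t + n y` of a function of the phase. It is encoded
as a derivative along `∂_t`, which assumes `d ≠ 0`. -/
def phaseDeriv (d : ℝ) (f : Total → ℝ) (z : Total) : ℝ := fderiv ℝ f z (d⁻¹ • baseVec 2)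

/-- A smooth function on `Ω` that locally depends only on the phase `d t + n y`. -/
structure DependsOnPhase (n d : ℝ) (Ω : Set Total) (f : Total → ℝ) : Prop where
  contDiffOn : ContDiffOn ℝ ∞ f Ω
  fderiv_apply : ∀ z ∈ Ω, ∀ b, fderiv ℝ f z b = phaseForm n d b * phaseDeriv d f z

variable {n d : ℝ} {Ω : Set Total} {f g : Total → ℝ} {z : Total}

theorem phaseForm_apply (n d : ℝ) (b : Total) : phaseForm n d b = d * b.1 2 + n * b.1 1 := rfl

theorem phaseForm_zero_mk (n d : ℝ) (s : Fib) : phaseForm n d (0, s) = 0 := by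
  simp [phaseForm_apply]

theorem phaseForm_single_mk (n d : ℝ) (i : Fin 3) (s : Fib) :
    phaseForm n d (Pi.single i 1, s) = ![0, n, d] i := by
  fin_cases i <;> simp [phaseForm_apply]

theorem phaseForm_fibVec (n d : ℝ) (α : Fin 3) : phaseForm n d (fibVec α) = 0 :=
  phaseForm_zero_mk n d _

theorem phaseForm_baseVec (n d : ℝ) (i : Fin 3) : phaseForm n d (baseVec i) = ![0, n, d] i :=
  phaseForm_single_mk n d i 0

theorem DependsOnPhase.differentiableAt (hf : DependsOnPhase n d Ω f) (hΩ : IsOpen Ω)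
    (hz : z ∈ Ω) : DifferentiableAt ℝ f z :=
  differentiableAt_of_contDiffOn hΩ hf.contDiffOn hz

theorem DependsOnPhase.deriv (hf : DependsOnPhase n d Ω f) (hΩ : IsOpen Ω) :
    DependsOnPhase n d Ω (phaseDeriv d f) := by
  have hsmooth := contDiffOn_fderiv_apply hΩ hf.contDiffOn (d⁻¹ • baseVec 2)
  refine ⟨hsmooth, fun z hz b => ?_⟩
  have h₂ := contDiffAt_two_of_contDiffOn hΩ hf.contDiffOn hz
  have hd : DifferentiableAt ℝ (phaseDeriv d f) z := differentiableAt_of_contDiffOn hΩ hsmooth hz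
  have hb : Ω.EqOn (fun y => fderiv ℝ f y b) fun y => phaseForm n d b * phaseDeriv d f y :=
    fun y hy => hf.fderiv_apply y hy b
  calc fderiv ℝ (phaseDeriv d f) z b
      = fderiv ℝ (fderiv ℝ f) z (d⁻¹ • baseVec 2) b := by
        rw [fderiv_fderiv_comm h₂, fderiv_fderiv_apply (differentiableAt_fderiv h₂)]
        rfl
    _ = phaseForm n d b * phaseDeriv d (phaseDeriv d f) z := by
        rw [fderiv_fderiv_eq_of_eqOn hΩ hf.contDiffOn hb hz, fderiv_const_mul hd]
        rfl

end PhaseFunctions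

theorem Coeffs.IsSymmetryAt.snd_apply_fibVec_zero {K : Coeffs} {n d : ℝ} {r : Fib} {v : Total}
    {L : Total →L[ℝ] Total} {H : Total →L[ℝ] Total →L[ℝ] Total} {μ : ℝ}
    (h : K.IsSymmetryAt r v L H) (hK : K.Nondegenerate n d) (hμ : IsHomotheticAt L H μ)
    {α : Fin 3} (hα : α ≠ 2) (b : Total) : (H b (fibVec 0)).2 α
      = phaseForm n d b * (H (d⁻¹ • baseVec 2) (fibVec 0)).2 α := by
  have hd := hK.d_ne
  have hx : (H (baseVec 0) (fibVec 0)).2 α = 0 :=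
    congrFun (h.snd_apply_baseVec_zero_fib hK.a_ne hμ _) α
  have hfib : (H (0, b.2) (fibVec 0)).2 α = 0 := congrFun (h.snd_apply_fib_fib hK.a_ne hμ _ _) α
  have hnull : (H (d • baseVec 1 - n • baseVec 2) (fibVec 0)).2 α = 0 := by
    obtain ⟨hu, hv⟩ := h.snd_apply_null_fibVec_zero hK hμ
    fin_cases α <;> [exact hu; exact hv; exact absurd rfl hα]
  simp only [map_sub, map_smul, sub_apply, smul_apply, Prod.snd_sub, Prod.smul_snd, Pi.sub_apply,
    Pi.smul_apply, smul_eq_mul] at hnull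
  conv_lhs => rw [eq_sum_baseVec_add b]
  simp only [Fin.sum_univ_three, map_add, map_smul, add_apply, smul_apply, Prod.snd_add,
    Prod.smul_snd, Pi.add_apply, Pi.smul_apply, smul_eq_mul, hx, hfib, phaseForm_apply]
  field_simp
  linear_combination b.1 1 * hnull

theorem differentiableAt_fib (α : Fin 3) (z : Total) :
    DifferentiableAt ℝ (fun y : Total => y.2 α) z := by
  fun_prop

theorem fderiv_fib_mul (α : Fin 3) {f : Total → ℝ} {z : Total} (hf : DifferentiableAt ℝ f z)
    (b : Total) : fderiv ℝ (fun y => y.2 α * f y) z b = b.2 α * f z + z.2 α * fderiv ℝ f z b := by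
  have hfib := fderiv_snd_apply_apply (f := id) (z := z) differentiableAt_id b α
  simp only [id, fderiv_id, ContinuousLinearMap.id_apply] at hfib
  rw [fderiv_fun_mul (differentiableAt_fib α z) hf, add_apply, smul_apply, smul_apply, hfib,
    smul_eq_mul, smul_eq_mul]
  ring

/-- The real part of the complex number by which a fibrewise complex linear vector field
multiplies `ψ`. -/
def dilationCoeff (V : Total → Total) (z : Total) : ℝ := (fderiv ℝ V z (fibVec 0)).2 0

/-- The imaginary part of the complex number by which a fibrewise complex linear vector field
multiplies `ψ`. -/
def rotationCoeff (V : Total → Total) (z : Total) : ℝ := (fderiv ℝ V z (fibVec 0)).2 1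

namespace Coeffs.IsSymmetryOn

variable {K : Coeffs} {n d : ℝ} {Ω : Set Total} {V : Total → Total} {z : Total}

theorem dependsOnPhase_fderiv_fibVec_zero (hV : K.IsSymmetryOn Ω V) (hK : K.Nondegenerate n d)
    (hΩ : IsOpen Ω) {α : Fin 3} (hα : α ≠ 2) :
    DependsOnPhase n d Ω fun z => (fderiv ℝ V z (fibVec 0)).2 α := by
  have hsmooth := contDiffOn_fderiv_apply hΩ hV.1 (fibVec 0)
  refine ⟨contDiffOn_pi.1 hsmooth.snd α, fun z hz b => ?_⟩
  have hsecond (a : Total) : fderiv ℝ (fun y => (fderiv ℝ V y (fibVec 0)).2 α) z a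
      = (fderiv ℝ (fderiv ℝ V) z a (fibVec 0)).2 α := by
    rw [fderiv_snd_apply_apply (differentiableAt_of_contDiffOn hΩ hsmooth hz),
      fderiv_fderiv_apply (differentiableAt_fderiv (contDiffAt_two_of_contDiffOn hΩ hV.1 hz))]
  rw [phaseDeriv, hsecond, hsecond,
    (hV.2 z hz).snd_apply_fibVec_zero hK (hV.isHomotheticAt hK hΩ hz) hα]

theorem dependsOnPhase_dilationCoeff (hV : K.IsSymmetryOn Ω V) (hK : K.Nondegenerate n d)
    (hΩ : IsOpen Ω) : DependsOnPhase n d Ω (dilationCoeff V) :=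
  hV.dependsOnPhase_fderiv_fibVec_zero hK hΩ (by decide)

theorem dependsOnPhase_rotationCoeff (hV : K.IsSymmetryOn Ω V) (hK : K.Nondegenerate n d)
    (hΩ : IsOpen Ω) : DependsOnPhase n d Ω (rotationCoeff V) :=
  hV.dependsOnPhase_fderiv_fibVec_zero hK hΩ (by decide)

theorem snd_fderiv_fibVec_two_eq (hV : K.IsSymmetryOn Ω V) (hK : K.Nondegenerate n d)
    (hΩ : IsOpen Ω) (hz : z ∈ Ω) : (fderiv ℝ V z (fibVec 2)).2 2 = 2 * dilationCoeff V z := by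
  set ρ : Total → ℝ := fun y => (fderiv ℝ V y (fibVec 2)).2 2
  have hsmooth := contDiffOn_fderiv_apply hΩ hV.1 (fibVec 2)
  have hα := hV.dependsOnPhase_dilationCoeff hK hΩ
  have hβ := hV.dependsOnPhase_rotationCoeff hK hΩ
  have hρ : DifferentiableAt ℝ ρ z :=
    differentiableAt_of_contDiffOn hΩ (contDiffOn_pi.1 hsmooth.snd 2) hz
  have hρu : fderiv ℝ ρ z (fibVec 0) = 0 := by
    rw [fderiv_snd_apply_apply (differentiableAt_of_contDiffOn hΩ hsmooth hz),
      ← fderiv_fderiv_apply (differentiableAt_fderiv (contDiffAt_two_of_contDiffOn hΩ hV.1 hz))]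
    exact congrFun
      ((hV.2 z hz).snd_apply_fib_fib hK.a_ne (hV.isHomotheticAt hK hΩ hz) _ _) 2
  have heuler : Ω.EqOn (fun y => (V y).2 0)
      fun y => y.2 0 * (ρ y - dilationCoeff V y) - y.2 1 * rotationCoeff V y := fun y hy => by
    simp only [dilationCoeff, rotationCoeff, ρ]
    linear_combination ((hV.2 y hy).euler hK (hV.isHomotheticAt hK hΩ hy)).1
  have hu := fderiv_snd_apply_apply (differentiableAt_of_contDiffOn hΩ hV.1 hz) (fibVec 0) 0
  have hρα := hρ.fun_sub (hα.differentiableAt hΩ hz)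
  rw [fderiv_eq_of_eqOn hΩ heuler hz,
    fderiv_fun_sub ((differentiableAt_fib 0 z).fun_mul hρα)
      ((differentiableAt_fib 1 z).fun_mul (hβ.differentiableAt hΩ hz)),
    sub_apply, fderiv_fib_mul 0 hρα, fderiv_fib_mul 1 (hβ.differentiableAt hΩ hz),
    fderiv_fun_sub hρ (hα.differentiableAt hΩ hz), sub_apply, hρu, hα.fderiv_apply z hz,
    hβ.fderiv_apply z hz, phaseForm_fibVec] at hu
  have hρ_sub : ρ z - dilationCoeff V z = dilationCoeff V z := by
    simpa [fibVec, dilationCoeff] using hu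
  exact (sub_eq_iff_eq_add.1 hρ_sub).trans (two_mul _).symm

theorem snd_eq (hV : K.IsSymmetryOn Ω V) (hK : K.Nondegenerate n d) (hΩ : IsOpen Ω)
    (hz : z ∈ Ω) :
    (V z).2 0 = z.2 0 * dilationCoeff V z - z.2 1 * rotationCoeff V z ∧
      (V z).2 1 = z.2 0 * rotationCoeff V z + z.2 1 * dilationCoeff V z := by
  have hμ := hV.isHomotheticAt hK hΩ hz
  obtain ⟨hu, hv⟩ := (hV.2 z hz).euler hK hμ
  obtain ⟨-, hvu, hvv⟩ := (hV.2 z hz).complex_linear hK hμ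
  rw [hV.snd_fderiv_fibVec_two_eq hK hΩ hz] at hu hv
  simp only [dilationCoeff, rotationCoeff] at hu hv ⊢
  constructor
  · linear_combination hu
  · linear_combination hv - z.2 0 * hvu - z.2 1 * hvv

end Coeffs.IsSymmetryOn

theorem fderiv_snd_baseVec_of_snd_eq {n d : ℝ} {Ω : Set Total} {W : Total → Total} {z : Total}
    {f g : Total → ℝ} (hΩ : IsOpen Ω) (hz : z ∈ Ω) (hW : DifferentiableAt ℝ W z)
    (hf : DependsOnPhase n d Ω f) (hg : DependsOnPhase n d Ω g) (c : ℝ)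
    (h : ∀ y ∈ Ω, (W y).2 0 = c * (y.2 0 * f y - y.2 1 * g y) ∧
      (W y).2 1 = c * (y.2 0 * g y + y.2 1 * f y)) (i : Fin 3) :
    (fderiv ℝ W z (baseVec i)).2 0 = phaseForm n d (baseVec i) * c
        * (z.2 0 * phaseDeriv d f z - z.2 1 * phaseDeriv d g z) ∧
      (fderiv ℝ W z (baseVec i)).2 1 = phaseForm n d (baseVec i) * c
        * (z.2 0 * phaseDeriv d g z + z.2 1 * phaseDeriv d f z) := by
  have hf' := hf.differentiableAt hΩ hz
  have hg' := hg.differentiableAt hΩ hz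
  have hmul {k : Total → ℝ} (hk : DifferentiableAt ℝ k z) (α : Fin 3) :=
    (differentiableAt_fib α z).fun_mul hk
  rw [← fderiv_snd_apply_apply hW, ← fderiv_snd_apply_apply hW,
    fderiv_eq_of_eqOn hΩ (fun y hy => (h y hy).1) hz,
    fderiv_eq_of_eqOn hΩ (fun y hy => (h y hy).2) hz,
    fderiv_const_mul ((hmul hf' 0).fun_sub (hmul hg' 1)),
    fderiv_const_mul ((hmul hg' 0).fun_add (hmul hf' 1)),
    fderiv_fun_sub (hmul hf' 0) (hmul hg' 1), fderiv_fun_add (hmul hg' 0) (hmul hf' 1)]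
  simp only [smul_apply, add_apply, sub_apply, fderiv_fib_mul _ hf', fderiv_fib_mul _ hg',
    hf.fderiv_apply z hz, hg.fderiv_apply z hz, baseVec, smul_eq_mul, Pi.zero_apply]
  constructor <;> ring

namespace Coeffs.IsSymmetryOn

variable {K : Coeffs} {n d : ℝ} {Ω : Set Total} {V : Total → Total} {z : Total}

theorem fderiv_snd_baseVec (hV : K.IsSymmetryOn Ω V) (hK : K.Nondegenerate n d) (hΩ : IsOpen Ω)
    (hz : z ∈ Ω) (i : Fin 3) :
    (fderiv ℝ V z (baseVec i)).2 0 = phaseForm n d (baseVec i)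
        * (z.2 0 * phaseDeriv d (dilationCoeff V) z - z.2 1 * phaseDeriv d (rotationCoeff V) z) ∧
      (fderiv ℝ V z (baseVec i)).2 1 = phaseForm n d (baseVec i)
        * (z.2 0 * phaseDeriv d (rotationCoeff V) z
          + z.2 1 * phaseDeriv d (dilationCoeff V) z) := by
  simpa only [mul_one] using fderiv_snd_baseVec_of_snd_eq hΩ hz
    (differentiableAt_of_contDiffOn hΩ hV.1 hz) (hV.dependsOnPhase_dilationCoeff hK hΩ)
    (hV.dependsOnPhase_rotationCoeff hK hΩ) 1
    (fun y hy => by simpa only [one_mul] using hV.snd_eq hK hΩ hy) i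

theorem fderiv_fderiv_snd_baseVec (hV : K.IsSymmetryOn Ω V) (hK : K.Nondegenerate n d)
    (hΩ : IsOpen Ω) (hz : z ∈ Ω) (i j : Fin 3) :
    (fderiv ℝ (fderiv ℝ V) z (baseVec i) (baseVec j)).2 0
        = phaseForm n d (baseVec i) * phaseForm n d (baseVec j)
          * (z.2 0 * phaseDeriv d (phaseDeriv d (dilationCoeff V)) z
            - z.2 1 * phaseDeriv d (phaseDeriv d (rotationCoeff V)) z) ∧
      (fderiv ℝ (fderiv ℝ V) z (baseVec i) (baseVec j)).2 1
        = phaseForm n d (baseVec i) * phaseForm n d (baseVec j)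
          * (z.2 0 * phaseDeriv d (phaseDeriv d (rotationCoeff V)) z
            + z.2 1 * phaseDeriv d (phaseDeriv d (dilationCoeff V)) z) := by
  rw [fderiv_fderiv_apply (differentiableAt_fderiv (contDiffAt_two_of_contDiffOn hΩ hV.1 hz))]
  exact fderiv_snd_baseVec_of_snd_eq hΩ hz
    (differentiableAt_of_contDiffOn hΩ (contDiffOn_fderiv_apply hΩ hV.1 _) hz)
    ((hV.dependsOnPhase_dilationCoeff hK hΩ).deriv hΩ)
    ((hV.dependsOnPhase_rotationCoeff hK hΩ).deriv hΩ) _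
    (fun y hy => hV.fderiv_snd_baseVec hK hΩ hy j) i

theorem determining_equations (hV : K.IsSymmetryOn Ω V) (hK : K.Nondegenerate n d) (hΩ : IsOpen Ω)
    (hz : z ∈ Ω) :
    K.w * z.2 0 * (V z).2 2 - 2 * K.κ * (z.2 0 ^ 2 + z.2 1 ^ 2) * (z.2 0 * dilationCoeff V z)
        = (K.a₁ * d + K.a₅ * n) * (z.2 0 * phaseDeriv d (rotationCoeff V) z
          + z.2 1 * phaseDeriv d (dilationCoeff V) z) ∧
      K.w * z.2 1 * (V z).2 2 - 2 * K.κ * (z.2 0 ^ 2 + z.2 1 ^ 2) * (z.2 1 * dilationCoeff V z)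
        = (K.a₁ * d + K.a₅ * n) * (z.2 1 * phaseDeriv d (rotationCoeff V) z
          - z.2 0 * phaseDeriv d (dilationCoeff V) z) ∧
      (fderiv ℝ (fderiv ℝ V) z (baseVec 0) (baseVec 0)).2 2
        + K.σ * ((fderiv ℝ (fderiv ℝ V) z (baseVec 1) (baseVec 1)).2 2
          - (fderiv ℝ (fderiv ℝ V) z (baseVec 2) (baseVec 2)).2 2)
        = 2 * n ^ 2 * (z.2 0 ^ 2 + z.2 1 ^ 2)
          * phaseDeriv d (phaseDeriv d (dilationCoeff V)) z := by
  have hα : (fderiv ℝ V z (fibVec 0)).2 0 = dilationCoeff V z := rfl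
  have hβ : (fderiv ℝ V z (fibVec 0)).2 1 = rotationCoeff V z := rfl
  obtain ⟨hηu, hηv⟩ := hV.snd_eq hK hΩ hz
  have hL (i : Fin 3) := hV.fderiv_snd_baseVec hK hΩ hz i
  have hH (i j : Fin 3) := hV.fderiv_fderiv_snd_baseVec hK hΩ hz i j
  have hzero := (hV.2 z hz).zero_gradient_equation hK (hV.isHomotheticAt hK hΩ hz)
  have hu := congrFun hzero 0
  have hv := congrFun hzero 1
  have hφ := congrFun hzero 2
  simp only [principal, lowerLinearization, drift, Matrix.cons_val,
    Pi.add_apply, Pi.smul_apply, Pi.zero_apply, smul_eq_mul, hα, hβ, hηu, hηv, hL, hH,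
    phaseForm_baseVec] at hu hv hφ
  refine ⟨?_, ?_, ?_⟩
  · linear_combination hu - (z.2 0 * phaseDeriv d (phaseDeriv d (dilationCoeff V)) z
      - z.2 1 * phaseDeriv d (phaseDeriv d (rotationCoeff V)) z) * hK.null_form
  · linear_combination hv - (z.2 0 * phaseDeriv d (phaseDeriv d (rotationCoeff V)) z
      + z.2 1 * phaseDeriv d (phaseDeriv d (dilationCoeff V)) z) * hK.null_form
  · linear_combination hφ

end Coeffs.IsSymmetryOn

namespace Coeffs.IsSymmetryOn

variable {K : Coeffs} {n d : ℝ} {Ω : Set Total} {V : Total → Total} {z : Total}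

theorem phaseDeriv_dilationCoeff_eq_zero (hV : K.IsSymmetryOn Ω V) (hK : K.Nondegenerate n d)
    (hΩ : IsOpen Ω) (hz : z ∈ Ω) : phaseDeriv d (dilationCoeff V) z = 0 := by
  have hα := (hV.dependsOnPhase_dilationCoeff hK hΩ).deriv hΩ
  refine eqOn_of_fib_ne_zero hΩ 0 hα.contDiffOn.continuousOn continuousOn_const
    (fun y hy hy0 => ?_) hz
  obtain ⟨hu, hv, -⟩ := hV.determining_equations hK hΩ hy
  have hr : 0 < y.2 0 ^ 2 + y.2 1 ^ 2 := by positivity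
  refine (mul_eq_zero.1 ?_).resolve_left (mul_ne_zero hK.drift_ne hr.ne')
  linear_combination y.2 0 * hv - y.2 1 * hu

theorem mul_snd_two_eq (hV : K.IsSymmetryOn Ω V) (hK : K.Nondegenerate n d) (hΩ : IsOpen Ω)
    (hz : z ∈ Ω) : K.w * (V z).2 2 = (K.a₁ * d + K.a₅ * n) * phaseDeriv d (rotationCoeff V) z
      + 2 * K.κ * (z.2 0 * (z.2 0 * dilationCoeff V z) + z.2 1 * (z.2 1 * dilationCoeff V z)) := by
  have hα := (hV.dependsOnPhase_dilationCoeff hK hΩ).contDiffOn.continuousOn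
  have hβ := ((hV.dependsOnPhase_rotationCoeff hK hΩ).deriv hΩ).contDiffOn.continuousOn
  have hη := (contDiffOn_pi.1 hV.1.snd 2).continuousOn
  have hmul {f : Total → ℝ} (i : Fin 3) (hf : ContinuousOn f Ω) :
      ContinuousOn (fun y => y.2 i * f y) Ω :=
    ((continuous_apply i).comp continuous_snd).continuousOn.mul hf
  refine eqOn_of_fib_ne_zero hΩ 0 (continuousOn_const.mul hη)
    ((continuousOn_const.mul hβ).add
      (continuousOn_const.mul ((hmul 0 (hmul 0 hα)).add (hmul 1 (hmul 1 hα)))))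
    (fun y hy hy0 => ?_) hz
  obtain ⟨hu, hv, -⟩ := hV.determining_equations hK hΩ hy
  have hr : 0 < y.2 0 ^ 2 + y.2 1 ^ 2 := by positivity
  refine mul_left_cancel₀ hr.ne' ?_
  simp only [Pi.add_apply, Pi.mul_apply]
  linear_combination y.2 0 * hu + y.2 1 * hv

theorem dilationCoeff_eq_zero (hV : K.IsSymmetryOn Ω V) (hK : K.Nondegenerate n d)
    (hΩ : IsOpen Ω) (hz : z ∈ Ω) : dilationCoeff V z = 0 := by
  have hα := hV.dependsOnPhase_dilationCoeff hK hΩ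
  have hβ := (hV.dependsOnPhase_rotationCoeff hK hΩ).deriv hΩ
  have hα' := hα.differentiableAt hΩ hz
  have hβ' := hβ.differentiableAt hΩ hz
  have hV' := differentiableAt_of_contDiffOn hΩ hV.1 hz
  have hmul (i : Fin 3) := (differentiableAt_fib i z).fun_mul hα'
  have hmul₂ (i : Fin 3) := (differentiableAt_fib i z).fun_mul (hmul i)
  have h := congrArg (· (fibVec 2))
    (fderiv_eq_of_eqOn hΩ (fun y hy => hV.mul_snd_two_eq hK hΩ hy) hz)
  have hη : DifferentiableAt ℝ (fun y => (V y).2 2) z := by fun_prop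
  rw [fderiv_const_mul hη,
    fderiv_fun_add (hβ'.const_mul _) (((hmul₂ 0).fun_add (hmul₂ 1)).const_mul _),
    fderiv_const_mul hβ', fderiv_const_mul ((hmul₂ 0).fun_add (hmul₂ 1)),
    fderiv_fun_add (hmul₂ 0) (hmul₂ 1)] at h
  simp only [smul_apply, add_apply, fderiv_snd_apply_apply hV', fderiv_fib_mul _ (hmul _),
    fderiv_fib_mul _ hα', hα.fderiv_apply z hz, hβ.fderiv_apply z hz, phaseForm_fibVec,
    hV.snd_fderiv_fibVec_two_eq hK hΩ hz] at h
  simpa [hK.w_ne, fibVec] using h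

theorem snd_two_eq (hV : K.IsSymmetryOn Ω V) (hK : K.Nondegenerate n d) (hΩ : IsOpen Ω)
    (hz : z ∈ Ω) :
    (V z).2 2 = (K.a₁ * d + K.a₅ * n) / K.w * phaseDeriv d (rotationCoeff V) z := by
  have h := hV.mul_snd_two_eq hK hΩ hz
  have hw := hK.w_ne
  rw [hV.dilationCoeff_eq_zero hK hΩ hz] at h
  field_simp
  linear_combination h

theorem fderiv_fderiv_snd_two (hV : K.IsSymmetryOn Ω V) (hK : K.Nondegenerate n d)
    (hΩ : IsOpen Ω) (hz : z ∈ Ω) (a b : Total) : (fderiv ℝ (fderiv ℝ V) z a b).2 2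
      = phaseForm n d a * phaseForm n d b * ((K.a₁ * d + K.a₅ * n) / K.w
        * phaseDeriv d (phaseDeriv d (phaseDeriv d (rotationCoeff V))) z) := by
  have hβ := (hV.dependsOnPhase_rotationCoeff hK hΩ).deriv hΩ
  have hfirst : Ω.EqOn (fun y => (fderiv ℝ V y b).2 2) fun y => (K.a₁ * d + K.a₅ * n) / K.w
      * (phaseForm n d b * phaseDeriv d (phaseDeriv d (rotationCoeff V)) y) := fun y hy => by
    beta_reduce
    rw [← fderiv_snd_apply_apply (differentiableAt_of_contDiffOn hΩ hV.1 hy),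
      fderiv_eq_of_eqOn hΩ (fun x hx => hV.snd_two_eq hK hΩ hx) hy,
      fderiv_const_mul (hβ.differentiableAt hΩ hy), smul_apply, hβ.fderiv_apply y hy, smul_eq_mul]
  have hβ' := (hβ.deriv hΩ).differentiableAt hΩ hz
  rw [fderiv_fderiv_apply (differentiableAt_fderiv (contDiffAt_two_of_contDiffOn hΩ hV.1 hz)),
    ← fderiv_snd_apply_apply
      (differentiableAt_of_contDiffOn hΩ (contDiffOn_fderiv_apply hΩ hV.1 b) hz),
    fderiv_eq_of_eqOn hΩ hfirst hz, fderiv_const_mul (hβ'.const_mul _), fderiv_const_mul hβ',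
    smul_apply, smul_apply, (hβ.deriv hΩ).fderiv_apply z hz, smul_eq_mul, smul_eq_mul]
  ring

theorem phaseDeriv_phaseDeriv_phaseDeriv_rotationCoeff (hV : K.IsSymmetryOn Ω V)
    (hK : K.Nondegenerate n d) (hΩ : IsOpen Ω) (hz : z ∈ Ω) :
    phaseDeriv d (phaseDeriv d (phaseDeriv d (rotationCoeff V))) z = 0 := by
  obtain ⟨-, -, hφ⟩ := hV.determining_equations hK hΩ hz
  have hα : phaseDeriv d (phaseDeriv d (dilationCoeff V)) z = 0 := by
    rw [phaseDeriv, fderiv_eq_of_eqOn hΩ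
      (fun y hy => hV.phaseDeriv_dilationCoeff_eq_zero hK hΩ hy) hz]
    simp
  simp only [hV.fderiv_fderiv_snd_two hK hΩ hz, phaseForm_baseVec, hα] at hφ
  have hσ : K.σ * (n ^ 2 - d ^ 2) * ((K.a₁ * d + K.a₅ * n) / K.w) ≠ 0 :=
    mul_ne_zero (mul_ne_zero hK.σ_ne hK.sq_sub_sq_ne) (div_ne_zero hK.drift_ne hK.w_ne)
  refine (mul_eq_zero.1 ?_).resolve_left hσ
  simp only [Matrix.cons_val] at hφ
  linear_combination hφ

end Coeffs.IsSymmetryOn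

section SymmetryFields

open Polynomial

/-- The field `q(s) (-v ∂_u + u ∂_v) + r(s) ∂_φ` of the phase `s = d t + n y`. -/
def phaseField (n d : ℝ) (q r : ℝ[X]) (z : Total) : Total :=
  q.eval (phaseForm n d z) • rot z + r.eval (phaseForm n d z) • dφ z

/-- The field `x + p(s) (-v ∂_u + u ∂_v) + k p'(s) ∂_φ`, where `x` is a translation of the
independent variables and `s = d t + n y`, as a linear function of the parameter `(x, p)`. -/
def symField (n d k : ℝ) : Base × ℝ[X] →ₗ[ℝ] Total → Total where
  toFun X z := (X.1, 0) + phaseField n d X.2 (k • derivative X.2) z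
  map_add' X Y := by
    ext z i <;> simp [phaseField] <;> ring
  map_smul' c X := by
    ext z i <;> simp [phaseField] <;> ring

variable {n d k : ℝ}

theorem symField_apply (X : Base × ℝ[X]) (z : Total) :
    symField n d k X z = (X.1, 0) + phaseField n d X.2 (k • derivative X.2) z := rfl

theorem isLinearMap_rot : IsLinearMap ℝ rot := by
  constructor <;> intros <;> ext i <;> fin_cases i <;> simp [rot, add_comm]

theorem differentiable_rot : Differentiable ℝ rot :=
  (isLinearMap_rot.mk' rot).toContinuousLinearMap.differentiable

theorem fderiv_rot (z b : Total) : fderiv ℝ rot z b = rot b :=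
  congrArg (· b) (isLinearMap_rot.mk' rot).toContinuousLinearMap.fderiv

theorem contDiff_phaseField (q r : ℝ[X]) : ContDiff ℝ ∞ (phaseField n d q r) :=
  ((q.contDiff_aeval ∞ |>.comp (phaseForm n d).contDiff).smul
    (isLinearMap_rot.mk' rot).toContinuousLinearMap.contDiff).add
    ((r.contDiff_aeval ∞ |>.comp (phaseForm n d).contDiff).smul contDiff_const)

theorem differentiable_phaseField (q r : ℝ[X]) : Differentiable ℝ (phaseField n d q r) :=
  (contDiff_phaseField q r).differentiable (by simp)

theorem hasFDerivAt_eval_phaseForm (p : ℝ[X]) (z : Total) :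
    HasFDerivAt (fun y => p.eval (phaseForm n d y))
      ((derivative p).eval (phaseForm n d z) • phaseForm n d) z :=
  (p.hasDerivAt _).comp_hasFDerivAt z (phaseForm n d).hasFDerivAt

theorem fderiv_phaseField (q r : ℝ[X]) (z b : Total) :
    fderiv ℝ (phaseField n d q r) z b = q.eval (phaseForm n d z) • rot b
      + phaseForm n d b • phaseField n d (derivative q) (derivative r) z := by
  have hq := (hasFDerivAt_eval_phaseForm (n := n) (d := d) q z).fun_smul
    (differentiable_rot z).hasFDerivAt
  have hr := (hasFDerivAt_eval_phaseForm (n := n) (d := d) r z).fun_smul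
    (hasFDerivAt_const ((0, ![0, 0, 1]) : Total) z)
  unfold phaseField dφ
  rw [(hq.fun_add hr).fderiv]
  simp only [add_apply, smul_apply, ContinuousLinearMap.smulRight_apply, fderiv_rot, zero_apply]
  module

theorem fderiv_fderiv_phaseField (q r : ℝ[X]) (z a b : Total) :
    fderiv ℝ (fderiv ℝ (phaseField n d q r)) z a b
      = (phaseForm n d a * (derivative q).eval (phaseForm n d z)) • rot b
        + phaseForm n d b • ((derivative q).eval (phaseForm n d z) • rot a
          + phaseForm n d a •
            phaseField n d (derivative (derivative q)) (derivative (derivative r)) z) := by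
  rw [fderiv_fderiv_apply (differentiableAt_fderiv
    ((contDiff_phaseField q r).contDiffAt.of_le (by norm_cast)))]
  simp only [fderiv_phaseField]
  rw [fderiv_fun_add ((hasFDerivAt_eval_phaseForm q z).differentiableAt.smul_const _)
    ((differentiable_phaseField _ _ z).fun_const_smul _),
    fderiv_smul_const (hasFDerivAt_eval_phaseForm q z).differentiableAt,
    fderiv_fun_const_smul (differentiable_phaseField _ _ z),
    (hasFDerivAt_eval_phaseForm q z).fderiv]
  simp only [add_apply, smul_apply, ContinuousLinearMap.smulRight_apply, fderiv_phaseField]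
  module

theorem contDiff_symField (X : Base × ℝ[X]) : ContDiff ℝ ∞ (symField n d k X) :=
  contDiff_const.add (contDiff_phaseField X.2 _)

theorem fderiv_symField (X : Base × ℝ[X]) :
    fderiv ℝ (symField n d k X) = fderiv ℝ (phaseField n d X.2 (k • derivative X.2)) :=
  funext fun _ => fderiv_const_add _

theorem phaseForm_symField (X : Base × ℝ[X]) (z : Total) :
    phaseForm n d (symField n d k X z) = phaseForm n d (X.1, 0) := by
  simp [symField_apply, phaseField, phaseForm_apply, rot, dφ]

theorem rot_symField (X : Base × ℝ[X]) (z : Total) :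
    rot (symField n d k X z) = X.2.eval (phaseForm n d z) • rot (rot z) := by
  ext i <;> fin_cases i <;> simp [symField_apply, phaseField, rot, dφ]

theorem lieBracket_symField (X Y : Base × ℝ[X]) :
    VectorField.lieBracket ℝ (symField n d k X) (symField n d k Y) = symField n d k
      (0, phaseForm n d (X.1, 0) • derivative Y.2 - phaseForm n d (Y.1, 0) • derivative X.2) := by
  funext z
  simp only [VectorField.lieBracket, fderiv_symField, fderiv_phaseField, phaseForm_symField,
    rot_symField]
  simp only [symField_apply, phaseField, map_sub, map_smul, eval_sub, eval_smul, smul_eq_mul,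
    Prod.mk_zero_zero]
  module

end SymmetryFields

namespace Coeffs.IsSymmetryOn

open Polynomial

variable {K : Coeffs} {n d : ℝ} {Ω : Set Total} {V W : Total → Total} {z : Total}

theorem congr (hV : K.IsSymmetryOn Ω V) (hΩ : IsOpen Ω) (hVW : Ω.EqOn W V) :
    K.IsSymmetryOn Ω W := by
  refine ⟨hV.1.congr hVW, fun z hz => ?_⟩
  have hnear : W =ᶠ[𝓝 z] V := hVW.eventuallyEq_of_mem (hΩ.mem_nhds hz)
  rw [hnear.self_of_nhds, hnear.fderiv_eq, hnear.fderiv.fderiv_eq]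
  exact hV.2 z hz

end Coeffs.IsSymmetryOn

section Classification

open Polynomial

variable {K : Coeffs} {n d : ℝ} {Ω : Set Total} {V : Total → Total} {f : Total → ℝ}

theorem isHomotheticAt_symField {k : ℝ} (X : Base × ℝ[X]) (z : Total) :
    IsHomotheticAt (fderiv ℝ (symField n d k X) z)
      (fderiv ℝ (fderiv ℝ (symField n d k X)) z) 0 where
  fst_apply b := by simp [fderiv_symField, fderiv_phaseField, phaseField, rot, dφ]
  fst_apply_apply a b := by
    simp [fderiv_symField, fderiv_fderiv_phaseField, phaseField, rot, dφ]
  symm := fderiv_fderiv_comm ((contDiff_symField X).contDiffAt.of_le (by norm_cast))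

theorem prolongAt_symField {k : ℝ} (X : Base × ℝ[X]) (z : Total) (f₁ : Fin 3 → Fib)
    {f₂ : Fin 3 → Fin 3 → Fib} (hsymm : ∀ i j, f₂ i j = f₂ j i) :
    prolongAt (symField n d k X z) (fderiv ℝ (symField n d k X) z)
        (fderiv ℝ (fderiv ℝ (symField n d k X)) z) f₁ f₂
      = (X.1, (phaseField n d X.2 (k • derivative X.2) z).2,
        fun i => (X.2.eval (phaseForm n d z) • rot (0, f₁ i)
          + (![0, n, d] i : ℝ) •
            phaseField n d (derivative X.2) (k • derivative (derivative X.2)) z).2,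
        fun i j => (X.2.eval (phaseForm n d z) • rot (0, f₂ i j)
          + (derivative X.2).eval (phaseForm n d z) •
            ((![0, n, d] i : ℝ) • rot (0, f₁ j) + (![0, n, d] j : ℝ) • rot (0, f₁ i))
          + ((![0, n, d] i : ℝ) * ![0, n, d] j) • phaseField n d (derivative (derivative X.2))
            (k • derivative (derivative (derivative X.2))) z).2) := by
  have hrot (i : Fin 3) (s : Fib) : rot (Pi.single i 1, s) = rot (0, s) := rfl
  rw [(isHomotheticAt_symField X z).prolongAt_eq f₁ hsymm]
  simp only [fderiv_symField, fderiv_phaseField, fderiv_fderiv_phaseField, tangentVec,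
    phaseForm_single_mk, phaseForm_zero_mk, hrot, map_smul]
  refine Prod.ext ?_ (Prod.ext ?_ (Prod.ext ?_ ?_))
  · simp [symField_apply, phaseField, rot, dφ]
  · simp [symField_apply]
  · simp
  · funext i j
    simp only [Prod.snd_add, Prod.smul_snd]
    module

theorem Coeffs.Nondegenerate.isSymmetryOn_symField (hK : K.Nondegenerate n d) (Ω : Set Total)
    {X : Base × ℝ[X]} (hX : X.2 ∈ degreeLT ℝ 3) :
    K.IsSymmetryOn Ω (symField n d ((K.a₁ * d + K.a₅ * n) / K.w) X) := by
  refine ⟨(contDiff_symField X).contDiffOn, fun z _ f₁ f₂ hsymm heq => ?_⟩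
  have hp : derivative (derivative (derivative X.2)) = 0 :=
    iterate_derivative_eq_zero_of_degree_lt (mem_degreeLT.1 hX)
  have hw : K.w * ((K.a₁ * d + K.a₅ * n) / K.w) = K.a₁ * d + K.a₅ * n :=
    mul_div_cancel₀ _ hK.w_ne
  have h₀ := congrFun heq 0
  have h₁ := congrFun heq 1
  rw [prolongAt_symField X z f₁ hsymm]
  simp only [principal, lowerOrder, drift, neg_mul, Pi.add_apply, Matrix.cons_val,
    Pi.zero_apply] at h₀ h₁
  set k := (K.a₁ * d + K.a₅ * n) / K.w
  generalize hA : X.2.eval (phaseForm n d z) = A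
  generalize hA' : (derivative X.2).eval (phaseForm n d z) = A'
  generalize hA'' : (derivative (derivative X.2)).eval (phaseForm n d z) = A''
  ext α
  fin_cases α <;>
    simp only [principal, lowerLinearization, drift, symField_apply, phaseField, rot, dφ, hp, hA,
      hA', hA'', eval_smul, eval_zero, smul_zero, Prod.smul_snd, Prod.snd_add, Pi.add_apply,
      Pi.smul_apply, smul_eq_mul, Pi.zero_apply, Fin.zero_eta, Fin.mk_one, Fin.reduceFinMk,
      Matrix.cons_val]
  · linear_combination -A * h₁ - A' * (f₁ 1 1 * hK.null_n + f₁ 2 1 * hK.null_d)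
      - z.2 1 * A'' * hK.null_form + z.2 0 * A' * hw
  · linear_combination A * h₀ + A' * (f₁ 1 0 * hK.null_n + f₁ 2 0 * hK.null_d)
      + z.2 0 * A'' * hK.null_form + z.2 1 * A' * hw
  · ring

theorem exists_eqOn_eval_phaseForm (hΩ : IsOpen Ω) (hconn : IsPreconnected Ω) (N : ℕ)
    (hf : DependsOnPhase n d Ω f) (hzero : ∀ z ∈ Ω, (phaseDeriv d)^[N] f z = 0) :
    ∃ p ∈ degreeLT ℝ N, Ω.EqOn f fun z => p.eval (phaseForm n d z) := by
  induction N generalizing f with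
  | zero => exact ⟨0, zero_mem _, fun z hz => by simpa using hzero z hz⟩
  | succ N ih =>
    obtain ⟨p, hp, hfp⟩ := ih (hf.deriv hΩ) hzero
    obtain ⟨q, hq, rfl⟩ := exists_derivative_eq hp
    have hqz := hasFDerivAt_eval_phaseForm (n := n) (d := d) q
    obtain ⟨c, hc⟩ := hΩ.exists_eq_add_of_fderiv_eq hconn
      (fun z hz => (hf.differentiableAt hΩ hz).differentiableWithinAt)
      (fun z _ => (hqz z).differentiableAt.differentiableWithinAt) fun z hz => by
        refine ContinuousLinearMap.ext fun b => ?_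
        rw [(hqz z).fderiv, hf.fderiv_apply z hz, hfp hz, smul_apply, smul_eq_mul, mul_comm]
    have hC : C c ∈ degreeLT ℝ (N + 1) :=
      mem_degreeLT.2 (degree_C_le.trans_lt (by exact_mod_cast N.succ_pos))
    exact ⟨q + C c, add_mem hq hC, fun z hz => by simpa using hc hz⟩

theorem Coeffs.IsSymmetryOn.exists_eqOn_symField (hV : K.IsSymmetryOn Ω V)
    (hK : K.Nondegenerate n d) (hΩ : IsOpen Ω) (hconn : IsPreconnected Ω) :
    ∃ X : Base × ℝ[X], X.2 ∈ degreeLT ℝ 3 ∧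
      Ω.EqOn V (symField n d ((K.a₁ * d + K.a₅ * n) / K.w) X) := by
  have hβ := hV.dependsOnPhase_rotationCoeff hK hΩ
  obtain ⟨x, hx⟩ := hV.exists_fst_eq hK hΩ hconn
  obtain ⟨p, hp, hβp⟩ := exists_eqOn_eval_phaseForm hΩ hconn 3 hβ
    fun z hz => hV.phaseDeriv_phaseDeriv_phaseDeriv_rotationCoeff hK hΩ hz
  refine ⟨(x, p), hp, fun z hz => ?_⟩
  have hβ' : phaseDeriv d (rotationCoeff V) z = (derivative p).eval (phaseForm n d z) := by
    rw [phaseDeriv, fderiv_eq_of_eqOn hΩ hβp hz, (hasFDerivAt_eval_phaseForm p z).fderiv]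
    simp only [smul_apply, map_smul, phaseForm_baseVec, Matrix.cons_val, smul_eq_mul]
    rw [mul_left_comm, inv_mul_cancel₀ hK.d_ne, mul_one]
  obtain ⟨hu, hv⟩ := hV.snd_eq hK hΩ hz
  have hφ := hV.snd_two_eq hK hΩ hz
  rw [hV.dilationCoeff_eq_zero hK hΩ hz, hβp hz] at hu hv
  rw [hβ'] at hφ
  ext i
  · simp [symField_apply, phaseField, rot, dφ, hx z hz]
  · fin_cases i <;> simp [symField_apply, phaseField, rot, dφ, hu, hv, hφ, mul_comm]

theorem Coeffs.Nondegenerate.isSymmetryOn_iff (hK : K.Nondegenerate n d) (hΩ : IsOpen Ω)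
    (hconn : IsPreconnected Ω) : K.IsSymmetryOn Ω V ↔ ∃ X : Base × ℝ[X], X.2 ∈ degreeLT ℝ 3 ∧
      Ω.EqOn V (symField n d ((K.a₁ * d + K.a₅ * n) / K.w) X) :=
  ⟨fun hV => hV.exists_eqOn_symField hK hΩ hconn,
    fun ⟨_, hX, hVX⟩ => (hK.isSymmetryOn_symField Ω hX).congr hΩ hVX⟩

end Classification

section LinearPullback

variable {E G : Type*} [NormedAddCommGroup E] [NormedSpace ℝ E] [NormedAddCommGroup G]
  [NormedSpace ℝ G]

theorem clm_pd (L : E →L[ℝ] G) {f : Base → E} {p : Base} (hf : DifferentiableAt ℝ f p)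
    (i : Fin 3) : L (pd i f p) = pd i (fun q => L (f q)) p :=
  (fderiv_clm_comp_apply L hf _).symm

theorem clm_pd_pd (L : E →L[ℝ] G) {f : Base → E} (hf : ContDiff ℝ 2 f) (i j : Fin 3) (p : Base) :
    L (pd i (pd j f) p) = pd i (pd j fun q => L (f q)) p := by
  rw [clm_pd L ((contDiff_pd hf one_add_one_eq_two.le j).differentiable one_ne_zero p)]
  exact congrArg (pd i · p) (funext fun q => clm_pd L (hf.differentiable two_ne_zero q) j)

theorem pd_comp_clm (A : Base →L[ℝ] Base) {F : Base → G} (hF : Differentiable ℝ F) (i : Fin 3)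
    (q : Base) : pd i (fun r => F (A r)) q = ∑ k, A (Pi.single i 1) k • pd k F (A q) := by
  rw [← fderiv_eq_sum_pd]
  exact DFunLike.congr_fun ((hF (A q)).hasFDerivAt.comp q A.hasFDerivAt).fderiv _

theorem pd_pd_comp_clm (A : Base →L[ℝ] Base) {F : Base → G} (hF : ContDiff ℝ 2 F) (i j : Fin 3)
    (q : Base) : pd i (pd j fun r => F (A r)) q
      = ∑ k, ∑ l, (A (Pi.single j 1) k * A (Pi.single i 1) l) • pd l (pd k F) (A q) := by
  have hd (k : Fin 3) : Differentiable ℝ (pd k F) :=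
    (contDiff_pd hF one_add_one_eq_two.le k).differentiable one_ne_zero
  have hdA (k : Fin 3) : DifferentiableAt ℝ (fun r => pd k F (A r)) q :=
    (hd k (A q)).comp q A.differentiableAt
  rw [funext fun r => pd_comp_clm A (hF.differentiable two_ne_zero) j r, pd,
    fderiv_fun_sum fun k _ => (hdA k).fun_const_smul _, sum_apply]
  refine Finset.sum_congr rfl fun k _ => ?_
  rw [fderiv_fun_const_smul (hdA k), smul_apply, ← pd, pd_comp_clm A (hd k), Finset.smul_sum]
  simp only [mul_smul]

end LinearPullback

theorem pd_pd_pd_comm {G : Type*} [NormedAddCommGroup G] [NormedSpace ℝ G] {F : Base → G}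
    (hF : ContDiff ℝ 3 F) (i j : Fin 3) (p : Base) :
    pd i (pd j (pd j F)) p = pd j (pd j (pd i F)) p := by
  rw [pd_comm (contDiff_pd hF (by norm_num) j).contDiffAt]
  exact congrArg (pd j · p) (funext fun q => pd_comm (hF.of_le (by norm_num)).contDiffAt i j)

theorem pd_pd_norm_sq {H : Type*} [NormedAddCommGroup H] [InnerProductSpace ℝ H] {g : Base → H}
    (hg : ContDiff ℝ 2 g) (i : Fin 3) (p : Base) :
    pd i (pd i fun q => ‖g q‖ ^ 2) p = 2 * (inner ℝ (g p) (pd i (pd i g) p) + ‖pd i g p‖ ^ 2) := by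
  have hd : Differentiable ℝ g := hg.differentiable two_ne_zero
  have hdi : Differentiable ℝ (pd i g) :=
    (contDiff_pd hg one_add_one_eq_two.le i).differentiable one_ne_zero
  have hfirst : (pd i fun q => ‖g q‖ ^ 2) = fun q => 2 * inner ℝ (g q) (pd i g q) := by
    funext q
    simpa [pd] using DFunLike.congr_fun (hd q).hasFDerivAt.norm_sq.fderiv (Pi.single i 1)
  rw [hfirst, pd, fderiv_const_mul ((hd p).inner ℝ (hdi p)), smul_apply,
    fderiv_inner_apply ℝ (hd p) (hdi p), ← pd, ← pd, real_inner_self_eq_norm_sq, smul_eq_mul]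

section Change

variable {G : Type*} [NormedAddCommGroup G] [NormedSpace ℝ G] (c d m : ℝ)

theorem isLinearMap_change : IsLinearMap ℝ (change c d m) := by
  constructor <;> intros <;> ext i <;> fin_cases i <;> simp [change] <;> ring

/-- The change of variables `change c d m` as a continuous linear map. -/
def changeCLM : Base →L[ℝ] Base :=
  ((isLinearMap_change c d m).mk' _).toContinuousLinearMap

theorem bijective_change {m : ℝ} (hm : 0 < m) (hdm : d ^ 2 - m ≠ 0) :
    Function.Bijective (change c d m) := by
  have hs : √m ≠ 0 := (Real.sqrt_pos.2 hm).ne'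
  refine Function.bijective_iff_has_inverse.2 ⟨fun p => ![p 0,
    (p 2 * (c * d - 1) - d * p 1) / (d ^ 2 - m),
    (m * p 1 - (m * c - d) * p 2) / (√m * (d ^ 2 - m))], fun q => ?_, fun p => ?_⟩ <;>
  · ext i
    fin_cases i <;>
      simp only [change, Fin.zero_eta, Fin.mk_one, Fin.reduceFinMk, Matrix.cons_val] <;>
      field_simp <;> ring

theorem contDiff_change {n : WithTop ℕ∞} : ContDiff ℝ n (change c d m) :=
  (changeCLM c d m).contDiff

theorem pd_comp_change {F : Base → G} (hF : Differentiable ℝ F) (i : Fin 3) (q : Base) :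
    pd i (fun r => F (change c d m r)) q
      = ∑ k, change c d m (Pi.single i 1) k • pd k F (change c d m q) :=
  pd_comp_clm (changeCLM c d m) hF i q

theorem pd_pd_comp_change {F : Base → G} (hF : ContDiff ℝ 2 F) (i j : Fin 3) (q : Base) :
    pd i (pd j fun r => F (change c d m r)) q = ∑ k, ∑ l,
      (change c d m (Pi.single j 1) k * change c d m (Pi.single i 1) l) •
        pd l (pd k F) (change c d m q) :=
  pd_pd_comp_clm (changeCLM c d m) hF i j q

theorem change_single_zero : change c d m (Pi.single 0 1) = Pi.single 0 1 := by
  ext k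
  fin_cases k <;> simp [change]

theorem change_single_one : change c d m (Pi.single 1 1) = ![0, m * c - d, m] := by
  simp [change]

theorem change_single_two :
    change c d m (Pi.single 2 1) = ![0, √m * (c * d - 1), d * √m] := by
  simp [change]

theorem pd_one_comp_change {F : Base → G} (hF : Differentiable ℝ F) (q : Base) :
    pd 1 (fun r => F (change c d m r)) q
      = (m * c - d) • pd 1 F (change c d m q) + m • pd 2 F (change c d m q) := by
  simp [pd_comp_change c d m hF, change_single_one, Fin.sum_univ_three]

theorem pd_two_comp_change {F : Base → G} (hF : Differentiable ℝ F) (q : Base) :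
    pd 2 (fun r => F (change c d m r)) q
      = (√m * (c * d - 1)) • pd 1 F (change c d m q) + (d * √m) • pd 2 F (change c d m q) := by
  simp [pd_comp_change c d m hF, change_single_two, Fin.sum_univ_three]

theorem drift_comp_change {m : ℝ} (hm : 0 < m) (hdm : d ^ 2 - m ≠ 0) {F : Base → G}
    (hF : Differentiable ℝ F) (q : Base) :
    ((d - m * c) / ((d ^ 2 - m) * √m)) • pd 2 (fun r => F (change c d m r)) q
      + ((d * c - 1) / (d ^ 2 - m)) • pd 1 (fun r => F (change c d m r)) q
      = pd 2 F (change c d m q) := by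
  have hs : √m ≠ 0 := (Real.sqrt_pos.2 hm).ne'
  rw [pd_one_comp_change c d m hF, pd_two_comp_change c d m hF]
  match_scalars <;> field_simp <;> ring

theorem pd_zero_pd_zero_comp_change {F : Base → G} (hF : ContDiff ℝ 2 F) (q : Base) :
    pd 0 (pd 0 fun r => F (change c d m r)) q = pd 0 (pd 0 F) (change c d m q) := by
  simp [pd_pd_comp_change c d m hF, change_single_zero, Fin.sum_univ_three]

theorem wave_comp_change {m : ℝ} (hm : 0 ≤ m) {F : Base → G}
    (hF : ContDiff ℝ 2 F) (q : Base) :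
    pd 1 (pd 1 fun r => F (change c d m r)) q - pd 2 (pd 2 fun r => F (change c d m r)) q
      = (d ^ 2 - m) • ((1 - m * c ^ 2) • pd 1 (pd 1 F) (change c d m q)
        - m • pd 2 (pd 2 F) (change c d m q) - (2 * m * c) • pd 2 (pd 1 F) (change c d m q)) := by
  have hD : √m ^ 2 = m := Real.sq_sqrt hm
  simp only [pd_pd_comp_change c d m hF, change_single_one, change_single_two, Fin.sum_univ_three,
    Matrix.cons_val, pd_comm hF.contDiffAt 1 2, zero_mul, mul_zero, zero_smul, zero_add]
  match_scalars <;> ring_nf <;> simp only [hD] <;> ring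

theorem dispersion_comp_change (ε₀ : ℝ) {m : ℝ} (hm : 0 ≤ m) (hdm : d ^ 2 - m ≠ 0)
    {F : Base → G} (hF : ContDiff ℝ 2 F) (q : Base) :
    (ε₀ * d ^ 2 / (d ^ 2 - m) ^ 2) • pd 1 (pd 1 fun r => F (change c d m r)) q
      + (ε₀ * m / (d ^ 2 - m) ^ 2) • pd 2 (pd 2 fun r => F (change c d m r)) q
      + (-(2 * ε₀ * d * √m) / (d ^ 2 - m) ^ 2) • pd 2 (pd 1 fun r => F (change c d m r)) q
      = ε₀ • pd 1 (pd 1 F) (change c d m q) := by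
  have hD : √m ^ 2 = m := Real.sq_sqrt hm
  simp only [pd_pd_comp_change c d m hF, change_single_one, change_single_two, Fin.sum_univ_three,
    Matrix.cons_val, pd_comm hF.contDiffAt 1 2, zero_mul, mul_zero, zero_smul, zero_add]
  match_scalars <;> field_simp <;> simp only [hD] <;> ring

end Change

section Components

variable {f : Base → Fib}

theorem inner_toC (r s : Fib) : inner ℝ (toC r) (toC s) = r 0 * s 0 + r 1 * s 1 := by
  simp [toC, Complex.inner, mul_comm]

theorem toC_pd {p : Base} (hf : DifferentiableAt ℝ f p) (i : Fin 3) :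
    toC (pd i f p) = pd i (fun q => toC (f q)) p := by
  simpa [complexify_apply] using clm_pd ((ContinuousLinearMap.fst ℝ ℂ ℝ).comp complexify) hf i

theorem toC_pd_pd (hf : ContDiff ℝ 2 f) (i j : Fin 3) (p : Base) :
    toC (pd i (pd j f) p) = pd i (pd j fun q => toC (f q)) p := by
  simpa [complexify_apply] using
    clm_pd_pd ((ContinuousLinearMap.fst ℝ ℂ ℝ).comp complexify) hf i j p

theorem pd_pd_apply (hf : ContDiff ℝ 2 f) (i j α : Fin 3) (p : Base) :
    pd i (pd j f) p α = pd i (pd j fun q => f q α) p :=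
  clm_pd_pd (ContinuousLinearMap.proj α) hf i j p

theorem pd_pd_norm_toC_sq (hf : ContDiff ℝ 2 f) (i : Fin 3) (p : Base) :
    pd i (pd i fun q => ‖toC (f q)‖ ^ 2) p
      = 2 * (f p 0 * pd i (pd i f) p 0 + f p 1 * pd i (pd i f) p 1
        + pd i f p 0 ^ 2 + pd i f p 1 ^ 2) := by
  have hf' : ContDiff ℝ 2 fun q => toC (f q) := by
    simpa [complexify_apply, Function.comp_def] using
      ((ContinuousLinearMap.fst ℝ ℂ ℝ).comp complexify).contDiff.comp hf
  rw [pd_pd_norm_sq hf', ← toC_pd_pd hf, ← toC_pd (hf.differentiable two_ne_zero p), inner_toC,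
    norm_toC_sq]
  ring

end Components

section Transform

variable {a b c ε₀ d m w : ℝ} {ψ : Base → ℂ} {φ : Base → ℝ}

theorem contDiff_transform {k n : WithTop ℕ∞} (hkn : k + 1 ≤ n) (hψ : ContDiff ℝ k ψ)
    (hφ : ContDiff ℝ n φ) : ContDiff ℝ k (transform c d m ψ φ) := by
  have hψ' : ContDiff ℝ k fun q => ψ (change c d m q) := hψ.comp (contDiff_change c d m)
  have hφ' : ContDiff ℝ n fun q => φ (change c d m q) := hφ.comp (contDiff_change c d m)
  refine contDiff_pi.2 fun i => ?_
  fin_cases i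
  exacts [Complex.reCLM.contDiff.comp hψ', Complex.imCLM.contDiff.comp hψ', contDiff_pd hφ' hkn 1]

theorem toC_transform (q : Base) : toC (transform c d m ψ φ q) = ψ (change c d m q) := rfl

theorem eqA_transform (hm : 0 < m) (hdm : d ^ 2 - m ≠ 0) (hψ : ContDiff ℝ 2 ψ)
    (hφ : ContDiff ℝ 3 φ) (h : SolvesOriginal a b c ε₀ d m w ψ φ) (p : Base) :
    eqA a b c ε₀ d m w (jet (transform c d m ψ φ) p) = 0 := by
  have hf : ContDiff ℝ 2 (transform c d m ψ φ) := contDiff_transform (by norm_num) hψ hφ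
  have hφ_value : transform c d m ψ φ p 2
      = m * pd 2 φ (change c d m p) + (m * c - d) * pd 1 φ (change c d m p) :=
    (pd_one_comp_change c d m (hφ.differentiable (by simp)) p).trans (add_comm _ _)
  have hdrift := drift_comp_change c d hm hdm (hψ.differentiable two_ne_zero) p
  have hdispersion := dispersion_comp_change c d ε₀ hm.le hdm hψ p
  simp only [Complex.real_smul] at hdrift hdispersion
  simp only [eqA, jet, hφ_value, toC_pd (hf.differentiable two_ne_zero p), toC_pd_pd hf,
    toC_transform, pd_zero_pd_zero_comp_change c d m hψ]
  linear_combination (h (change c d m p)).1 + Complex.I * hdrift + hdispersion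

theorem wave_comp_change_of_solvesOriginal (hm : 0 ≤ m) (hdm : d ^ 2 - m ≠ 0) (hψ : ContDiff ℝ 2 ψ)
    (hφ : ContDiff ℝ 2 φ) (h : SolvesOriginal a b c ε₀ d m w ψ φ) (q : Base) :
    pd 0 (pd 0 fun r => φ (change c d m r)) q + 1 / (d ^ 2 - m) *
        (pd 1 (pd 1 fun r => φ (change c d m r)) q - pd 2 (pd 2 fun r => φ (change c d m r)) q)
      = pd 1 (fun r => ‖ψ (change c d m r)‖ ^ 2) q := by
  have hN : Differentiable ℝ fun q => ‖ψ q‖ ^ 2 := (hψ.norm_sq ℝ).differentiable two_ne_zero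
  rw [pd_zero_pd_zero_comp_change c d m hφ, wave_comp_change c d hm hφ,
    pd_one_comp_change c d m hN, smul_eq_mul, one_div, inv_mul_cancel_left₀ hdm]
  simp only [smul_eq_mul]
  linear_combination (h (change c d m q)).2

theorem eqB_transform (hm : 0 ≤ m) (hdm : d ^ 2 - m ≠ 0) (hψ : ContDiff ℝ 2 ψ)
    (hφ : ContDiff ℝ 3 φ) (h : SolvesOriginal a b c ε₀ d m w ψ φ) (p : Base) :
    eqB d m (jet (transform c d m ψ φ) p) = 0 := by
  have hf : ContDiff ℝ 2 (transform c d m ψ φ) := contDiff_transform (by norm_num) hψ hφ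
  have hΦ : ContDiff ℝ 3 fun r => φ (change c d m r) := hφ.comp (contDiff_change c d m)
  have hd (i : Fin 3) : DifferentiableAt ℝ (pd i (pd i fun r => φ (change c d m r))) p :=
    (contDiff_pd (k := 1) (contDiff_pd (k := 2) hΦ (by norm_num) i) (by norm_num) i).differentiable
      one_ne_zero p
  have hφ₂ (i : Fin 3) : pd i (pd i (transform c d m ψ φ)) p 2
      = fderiv ℝ (pd i (pd i fun r => φ (change c d m r))) p (Pi.single 1 1) :=
    (pd_pd_apply hf i i 2 p).trans (pd_pd_pd_comm hΦ 1 i p).symm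
  have hnorm : pd 1 (pd 1 fun r => ‖ψ (change c d m r)‖ ^ 2) p = _ := pd_pd_norm_toC_sq hf 1 p
  rw [← funext (wave_comp_change_of_solvesOriginal hm hdm hψ (hφ.of_le (by norm_num)) h), pd,
    fderiv_fun_add (hd 0) (((hd 1).fun_sub (hd 2)).const_mul _),
    fderiv_const_mul ((hd 1).fun_sub (hd 2)), fderiv_fun_sub (hd 1) (hd 2)] at hnorm
  simp only [add_apply, sub_apply, smul_apply, smul_eq_mul] at hnorm
  simp only [eqB, jet, hφ₂]
  linear_combination hnorm

theorem system_jet_transform (hm : 0 < m) (hdm : d ^ 2 - m ≠ 0) (hψ : ContDiff ℝ 2 ψ)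
    (hφ : ContDiff ℝ 3 φ) (h : SolvesOriginal a b c ε₀ d m w ψ φ) (p : Base) :
    system a b c ε₀ d m w (jet (transform c d m ψ φ) p) = 0 :=
  Prod.ext (eqA_transform hm hdm hψ hφ h p) (eqB_transform hm.le hdm hψ hφ h p)

end Transform

section SymmetryAlgebra

open Polynomial

variable {n d k : ℝ} {Ω : Set Total} {V W : Total → Total}

/-- The restriction to `Ω` of the fields `symField n d k X`. -/
def restrictSymField (n d k : ℝ) (Ω : Set Total) : Base × ℝ[X] →ₗ[ℝ] Ω → Total :=
  LinearMap.funLeft ℝ Total Subtype.val ∘ₗ symField n d k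

/-- The space of the fields `x + p(s) (-v ∂_u + u ∂_v) + k p'(s) ∂_φ` on `Ω`, where `x` is a
translation of the independent variables, `deg p < 3` and `s = d t + n y`. -/
def symmetryAlgebra (n d k : ℝ) (Ω : Set Total) : Submodule ℝ (Ω → Total) :=
  (Submodule.prod ⊤ (degreeLT ℝ 3)).map (restrictSymField n d k Ω)

theorem domRestrict_mem_symmetryAlgebra : Ω.domRestrict V ∈ symmetryAlgebra n d k Ω ↔
    ∃ X : Base × ℝ[X], X.2 ∈ degreeLT ℝ 3 ∧ Ω.EqOn V (symField n d k X) := by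
  refine exists_congr fun X => and_congr ⟨And.right, fun h => ⟨Submodule.mem_top, h⟩⟩
    ⟨fun h z hz => (congrFun h ⟨z, hz⟩).symm, fun h => funext fun z => (h z.2).symm⟩

theorem derivative_mem_degreeLT {p : ℝ[X]} {N : ℕ} (hp : p ∈ degreeLT ℝ N) :
    derivative p ∈ degreeLT ℝ N :=
  mem_degreeLT.2 (degree_derivative_le.trans_lt (mem_degreeLT.1 hp))

theorem domRestrict_lieBracket_mem_symmetryAlgebra (hΩ : IsOpen Ω)
    (hV : Ω.domRestrict V ∈ symmetryAlgebra n d k Ω)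
    (hW : Ω.domRestrict W ∈ symmetryAlgebra n d k Ω) :
    Ω.domRestrict (VectorField.lieBracket ℝ V W) ∈ symmetryAlgebra n d k Ω := by
  rw [domRestrict_mem_symmetryAlgebra] at hV hW ⊢
  obtain ⟨X, hX, hVX⟩ := hV
  obtain ⟨Y, hY, hWY⟩ := hW
  refine ⟨(0, phaseForm n d (X.1, 0) • derivative Y.2 - phaseForm n d (Y.1, 0) • derivative X.2),
    sub_mem (Submodule.smul_mem _ _ (derivative_mem_degreeLT hY))
      (Submodule.smul_mem _ _ (derivative_mem_degreeLT hX)), fun z hz => ?_⟩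
  rw [← lieBracket_symField]
  exact (hVX.eventuallyEq_of_mem (hΩ.mem_nhds hz)).lieBracket_vectorField_eq
    (hWY.eventuallyEq_of_mem (hΩ.mem_nhds hz))

theorem infinite_image_phaseForm (hd : d ≠ 0) (hΩ : IsOpen Ω) (hne : Ω.Nonempty) :
    (phaseForm n d '' Ω).Infinite := by
  have hsurj : Function.Surjective (phaseForm n d) := fun s =>
    ⟨(s / d) • baseVec 2, by simp [phaseForm_baseVec, hd]⟩
  obtain ⟨z, hz⟩ := hne
  exact infinite_of_mem_nhds (phaseForm n d z)
    (((phaseForm n d).isOpenMap hsurj Ω hΩ).mem_nhds (Set.mem_image_of_mem _ hz))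

theorem ker_restrictSymField (hd : d ≠ 0) (hΩ : IsOpen Ω) (hne : Ω.Nonempty) :
    LinearMap.ker (restrictSymField n d k Ω) = ⊥ := by
  refine LinearMap.ker_eq_bot'.2 fun X hX => ?_
  have hzero : ∀ z ∈ Ω, symField n d k X z = 0 := fun z hz => congrFun hX ⟨z, hz⟩
  have hp : Ω.EqOn (fun z => X.2.eval (phaseForm n d z)) 0 := by
    refine eqOn_of_fib_ne_zero hΩ 0 (X.2.continuous.comp (phaseForm n d).continuous).continuousOn
      continuousOn_const fun z hz hu => ?_
    have hv := congrArg (fun y : Total => y.2 1) (hzero z hz)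
    simpa [symField_apply, phaseField, rot, dφ, hu] using hv
  refine Prod.ext ?_ (eq_zero_of_infinite_isRoot _
    ((infinite_image_phaseForm hd hΩ hne).mono (Set.image_subset_iff.2 hp)))
  obtain ⟨z, hz⟩ := hne
  simpa [symField_apply, phaseField, rot, dφ] using congrArg Prod.fst (hzero z hz)

/-- The parameters `(x, p)` of the six generators `gen d m w i`. -/
def genParam : Fin 6 → Base × ℝ[X] :=
  ![(Pi.single 2 1, 0), (Pi.single 0 1, 0), (Pi.single 1 1, 0), (0, 1), (0, X), (0, X ^ 2)]

theorem sum_smul_genParam (r : Fin 6 → ℝ) : ∑ i, r i • genParam i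
    = (![r 1, r 2, r 0], C (r 5) * X ^ 2 + C (r 4) * X + C (r 3)) := by
  refine Prod.ext (funext fun i => ?_) ?_
  · fin_cases i <;> simp [Fin.sum_univ_succ, genParam]
  · simp [Fin.sum_univ_succ, genParam, smul_eq_C_mul]
    ring

theorem linearIndependent_genParam : LinearIndependent ℝ genParam := by
  refine Fintype.linearIndependent_iff.2 fun r hr i => ?_
  rw [sum_smul_genParam, Prod.mk_eq_zero] at hr
  have hcoeff (j : ℕ) := congrArg (coeff · j) hr.2
  fin_cases i
  exacts [congrFun hr.1 2, congrFun hr.1 0, congrFun hr.1 1, by simpa using hcoeff 0,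
    by simpa using hcoeff 1, by simpa using hcoeff 2]

theorem span_range_genParam :
    Submodule.span ℝ (Set.range genParam) = Submodule.prod ⊤ (degreeLT ℝ 3) := by
  ext Y
  simp only [Submodule.mem_span_range_iff_exists_fun, sum_smul_genParam, Submodule.mem_prod,
    Submodule.mem_top, true_and, mem_degreeLT]
  constructor
  · rintro ⟨r, rfl⟩
    exact degree_quadratic_lt
  · refine fun hY => ⟨![Y.1 2, Y.1 0, Y.1 1, Y.2.coeff 0, Y.2.coeff 1, Y.2.coeff 2],
      Prod.ext (funext fun i => by fin_cases i <;> rfl) (Polynomial.ext fun j => ?_)⟩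
    match j with
    | 0 | 1 | 2 => simp [coeff_X, coeff_C]
    | j + 3 =>
      rw [coeff_eq_zero_of_degree_lt (degree_quadratic_lt.trans_le (by norm_cast; omega)),
        coeff_eq_zero_of_degree_lt (hY.trans_le (by norm_cast; omega))]

theorem gen_eq_symField (d m w : ℝ) (i : Fin 6) :
    gen d m w i = symField √m d (1 / (w * √m)) (genParam i) := by
  funext z
  fin_cases i <;>
    simp [gen, genParam, symField_apply, phaseField, phase, phaseForm_apply, rot, dφ]
  ring

end SymmetryAlgebra

section Generators

variable {a b c ε₀ d m w : ℝ} {Ω : Set Total}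

theorem drift_coeffs (hm : 0 < m) (hdm : d ^ 2 - m ≠ 0) :
    (coeffs a b c ε₀ d m w).a₁ * d + (coeffs a b c ε₀ d m w).a₅ * √m = 1 / √m := by
  have hs : √m ≠ 0 := (Real.sqrt_pos.2 hm).ne'
  have hD : √m ^ 2 = m := Real.sq_sqrt hm.le
  simp only [coeffs]
  field_simp
  linear_combination (d * c - 1) * hD

theorem nondegenerate_coeffs (ha : a ≠ 0) (hε₀ : ε₀ ≠ 0) (hd : d ≠ 0) (hm : 0 < m) (hw : w ≠ 0)
    (hdm : d ^ 2 - m ≠ 0) : (coeffs a b c ε₀ d m w).Nondegenerate √m d where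
  a_ne := ha
  a₄_ne := by
    have hs : √m ≠ 0 := (Real.sqrt_pos.2 hm).ne'
    simp [coeffs, *]
  σ_ne := one_div_ne_zero hdm
  w_ne := hw
  a₂_sub_a₃_ne := by
    have hsub : (coeffs a b c ε₀ d m w).a₂ - (coeffs a b c ε₀ d m w).a₃ = ε₀ / (d ^ 2 - m) := by
      simp only [coeffs]
      field_simp
    exact hsub ▸ div_ne_zero hε₀ hdm
  d_ne := hd
  sq_sub_sq_ne := by
    rw [Real.sq_sqrt hm.le]
    exact fun h => hdm (by linear_combination -h)
  null_n := by
    simp only [coeffs]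
    field_simp
    ring
  null_d := by
    simp only [coeffs]
    field_simp
    linear_combination (-2 * ε₀ * d) * Real.sq_sqrt hm.le
  drift_ne := by
    rw [drift_coeffs hm hdm]
    exact one_div_ne_zero (Real.sqrt_pos.2 hm).ne'

theorem domRestrict_mem_symmetryAlgebra_iff_isLieSymmetry (ha : a ≠ 0) (hε₀ : ε₀ ≠ 0) (hd : d ≠ 0)
    (hm : 0 < m) (hw : w ≠ 0) (hdm : d ^ 2 - m ≠ 0) (hΩ : IsOpen Ω) (hconn : IsPreconnected Ω)
    {V : Total → Total} :
    Ω.domRestrict V ∈ symmetryAlgebra √m d (1 / (w * √m)) Ω ↔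
      IsLieSymmetry (system a b c ε₀ d m w) Ω V := by
  rw [domRestrict_mem_symmetryAlgebra, isLieSymmetry_system_iff a b c ε₀ d m w hΩ,
    (nondegenerate_coeffs ha hε₀ hd hm hw hdm).isSymmetryOn_iff hΩ hconn, drift_coeffs hm hdm,
    div_div, mul_comm √m]
  rfl

theorem span_range_domRestrict_gen (d m w : ℝ) (Ω : Set Total) :
    Submodule.span ℝ (Set.range fun i => Ω.domRestrict (gen d m w i))
      = symmetryAlgebra √m d (1 / (w * √m)) Ω := by
  rw [symmetryAlgebra, ← span_range_genParam, Submodule.map_span, ← Set.range_comp]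
  simp only [gen_eq_symField]
  rfl

theorem linearIndependent_domRestrict_gen (hd : d ≠ 0) (m w : ℝ) (hΩ : IsOpen Ω)
    (hne : Ω.Nonempty) : LinearIndependent ℝ fun i => Ω.domRestrict (gen d m w i) := by
  simp only [gen_eq_symField]
  exact linearIndependent_genParam.map' (restrictSymField √m d (1 / (w * √m)) Ω)
    (ker_restrictSymField hd hΩ hne)

theorem exists_basis_symmetryAlgebra (hd : d ≠ 0) (m w : ℝ) (hΩ : IsOpen Ω) (hne : Ω.Nonempty) :
    ∃ B : Module.Basis (Fin 6) ℝ (symmetryAlgebra √m d (1 / (w * √m)) Ω),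
      ∀ i, (B i : Ω → Total) = Ω.domRestrict (gen d m w i) := by
  rw [← span_range_domRestrict_gen]
  have hli := linearIndependent_domRestrict_gen hd m w hΩ hne
  exact ⟨Module.Basis.span hli, fun i => congrArg Subtype.val (Module.Basis.span_apply hli i)⟩

open Polynomial in
theorem lieBracket_gen (d m w : ℝ) (i j : Fin 6) :
    VectorField.lieBracket ℝ (gen d m w i) (gen d m w j) = symField √m d (1 / (w * √m))
      (0, phaseForm √m d ((genParam i).1, 0) • derivative (genParam j).2
        - phaseForm √m d ((genParam j).1, 0) • derivative (genParam i).2) := by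
  rw [gen_eq_symField, gen_eq_symField, lieBracket_symField]

theorem lieBracket_gen_zero_four (d m w : ℝ) :
    VectorField.lieBracket ℝ (gen d m w 0) (gen d m w 4) = d • gen d m w 3 := by
  rw [lieBracket_gen, gen_eq_symField, ← map_smul (symField _ _ _)]
  congr 1
  simp [genParam, phaseForm_apply]

theorem lieBracket_gen_zero_five (d m w : ℝ) :
    VectorField.lieBracket ℝ (gen d m w 0) (gen d m w 5) = (2 * d) • gen d m w 4 := by
  rw [lieBracket_gen, gen_eq_symField, ← map_smul (symField _ _ _)]
  congr 1
  simp [genParam, phaseForm_apply, two_mul, add_mul, add_smul]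

theorem lieBracket_gen_two_four (d m w : ℝ) :
    VectorField.lieBracket ℝ (gen d m w 2) (gen d m w 4) = √m • gen d m w 3 := by
  rw [lieBracket_gen, gen_eq_symField, ← map_smul (symField _ _ _)]
  congr 1
  simp [genParam, phaseForm_apply]

theorem lieBracket_gen_two_five (d m w : ℝ) :
    VectorField.lieBracket ℝ (gen d m w 2) (gen d m w 5) = (2 * √m) • gen d m w 4 := by
  rw [lieBracket_gen, gen_eq_symField, ← map_smul (symField _ _ _)]
  congr 1
  simp [genParam, phaseForm_apply, two_mul, add_mul, add_smul]

theorem lieBracket_gen_eq_zero (d m w : ℝ) {i j : Fin 6} (hij : i < j)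
    (hne : (i, j) ∉ ({(0, 4), (0, 5), (2, 4), (2, 5)} : Set (Fin 6 × Fin 6))) :
    VectorField.lieBracket ℝ (gen d m w i) (gen d m w j) = 0 := by
  rw [lieBracket_gen, ← map_zero (symField √m d (1 / (w * √m)))]
  congr 1
  fin_cases i <;> fin_cases j <;> simp [genParam, phaseForm_apply] at hij hne ⊢

end Generators

end BRZR

end

theorem mainTheorem3_general (a b c ε₀ d m w : ℝ) (ha : a ≠ 0) (hε₀ : ε₀ ≠ 0)
    (hd : d ≠ 0) (hm : 0 < m) (hw : w ≠ 0) (hdm : d ^ 2 - m ≠ 0) :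
    (Function.Bijective (BRZR.change c d m) ∧
      ∀ (ψ : BRZR.Base → ℂ) (φ : BRZR.Base → ℝ), ContDiff ℝ ∞ ψ → ContDiff ℝ ∞ φ →
        BRZR.SolvesOriginal a b c ε₀ d m w ψ φ →
          ∀ p, BRZR.system a b c ε₀ d m w (BRZR.jet (BRZR.transform c d m ψ φ) p) = 0) ∧
    (∀ Ω : Set BRZR.Total, IsOpen Ω → IsConnected Ω →
      ∃ 𝔤 : Submodule ℝ (Ω → BRZR.Total),
        (∀ V : BRZR.Total → BRZR.Total,
          Ω.domRestrict V ∈ 𝔤 ↔ BRZR.IsLieSymmetry (BRZR.system a b c ε₀ d m w) Ω V) ∧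
        (∀ V W : BRZR.Total → BRZR.Total, Ω.domRestrict V ∈ 𝔤 → Ω.domRestrict W ∈ 𝔤 →
          Ω.domRestrict (VectorField.lieBracket ℝ V W) ∈ 𝔤) ∧
        Module.finrank ℝ 𝔤 = 6 ∧
        ∃ B : Module.Basis (Fin 6) ℝ 𝔤,
          ∀ i, (B i : Ω → BRZR.Total) = Ω.domRestrict (BRZR.gen d m w i)) ∧
    (VectorField.lieBracket ℝ (BRZR.gen d m w 0) (BRZR.gen d m w 4) = d • BRZR.gen d m w 3 ∧
     VectorField.lieBracket ℝ (BRZR.gen d m w 0) (BRZR.gen d m w 5) = (2 * d) • BRZR.gen d m w 4 ∧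
     VectorField.lieBracket ℝ (BRZR.gen d m w 2) (BRZR.gen d m w 4) = √m • BRZR.gen d m w 3 ∧
     VectorField.lieBracket ℝ (BRZR.gen d m w 2) (BRZR.gen d m w 5) = (2 * √m) • BRZR.gen d m w 4 ∧
      ∀ i j : Fin 6, i < j →
        (i, j) ∉ ({(0, 4), (0, 5), (2, 4), (2, 5)} : Set (Fin 6 × Fin 6)) →
         VectorField.lieBracket ℝ (BRZR.gen d m w i) (BRZR.gen d m w j) = 0) := by
  refine ⟨⟨BRZR.bijective_change c d hm hdm, fun ψ φ hψ hφ h p =>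
      BRZR.system_jet_transform hm hdm (hψ.of_le (by norm_cast)) (hφ.of_le (by norm_cast)) h p⟩,
    fun Ω hΩ hconn => ?_, BRZR.lieBracket_gen_zero_four d m w, BRZR.lieBracket_gen_zero_five d m w,
    BRZR.lieBracket_gen_two_four d m w, BRZR.lieBracket_gen_two_five d m w,
    fun _ _ => BRZR.lieBracket_gen_eq_zero d m w⟩
  obtain ⟨B, hB⟩ := BRZR.exists_basis_symmetryAlgebra hd m w hΩ hconn.nonempty
  refine ⟨BRZR.symmetryAlgebra √m d (1 / (w * √m)) Ω, fun V => ?_, fun V W hV hW => ?_, ?_, B, hB⟩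
  · exact BRZR.domRestrict_mem_symmetryAlgebra_iff_isLieSymmetry ha hε₀ hd hm hw hdm hΩ
      hconn.isPreconnected
  · exact BRZR.domRestrict_lieBracket_mem_symmetryAlgebra hΩ hV hW
  · rw [Module.finrank_eq_card_basis B, Fintype.card_fin]

theorem mainTheorem3 (a b c ε₀ d m w : ℝ) (ha : a ≠ 0) (hb : b ≠ 0) (hc : c ≠ 0)
    (hε₀ : 0 < ε₀) (hd : 0 < d) (hm : 0 < m) (hw : 0 < w) (hdm : d ^ 2 - m ≠ 0) :
    -- the change of variables is invertible and leads to the transformed system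
    (Function.Bijective (BRZR.change c d m) ∧
      ∀ (ψ : BRZR.Base → ℂ) (φ : BRZR.Base → ℝ), ContDiff ℝ ∞ ψ → ContDiff ℝ ∞ φ →
        BRZR.SolvesOriginal a b c ε₀ d m w ψ φ →
          ∀ p, BRZR.system a b c ε₀ d m w (BRZR.jet (BRZR.transform c d m ψ φ) p) = 0) ∧
    -- on each domain, the infinitesimal symmetries form a six-dimensional Lie algebra
    (∀ Ω : Set BRZR.Total, IsOpen Ω → IsConnected Ω →
      ∃ 𝔤 : Submodule ℝ (Ω → BRZR.Total),
        (∀ V : BRZR.Total → BRZR.Total,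
          Ω.domRestrict V ∈ 𝔤 ↔ BRZR.IsLieSymmetry (BRZR.system a b c ε₀ d m w) Ω V) ∧
        (∀ V W : BRZR.Total → BRZR.Total, Ω.domRestrict V ∈ 𝔤 → Ω.domRestrict W ∈ 𝔤 →
          Ω.domRestrict (VectorField.lieBracket ℝ V W) ∈ 𝔤) ∧
        Module.finrank ℝ 𝔤 = 6 ∧
        ∃ B : Module.Basis (Fin 6) ℝ 𝔤,
          ∀ i, (B i : Ω → BRZR.Total) = Ω.domRestrict (BRZR.gen d m w i)) ∧
    -- the commutators
    (VectorField.lieBracket ℝ (BRZR.gen d m w 0) (BRZR.gen d m w 4) = d • BRZR.gen d m w 3 ∧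
     VectorField.lieBracket ℝ (BRZR.gen d m w 0) (BRZR.gen d m w 5) = (2 * d) • BRZR.gen d m w 4 ∧
     VectorField.lieBracket ℝ (BRZR.gen d m w 2) (BRZR.gen d m w 4) = √m • BRZR.gen d m w 3 ∧
     VectorField.lieBracket ℝ (BRZR.gen d m w 2) (BRZR.gen d m w 5) = (2 * √m) • BRZR.gen d m w 4 ∧
      ∀ i j : Fin 6, i < j →
        (i, j) ∉ ({(0, 4), (0, 5), (2, 4), (2, 5)} : Set (Fin 6 × Fin 6)) →
         VectorField.lieBracket ℝ (BRZR.gen d m w i) (BRZR.gen d m w j) = 0) :=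
  mainTheorem3_general a b c ε₀ d m w ha hε₀.ne' hd.ne' hm hw.ne' hdm
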